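/- **Theorem 1 (point equivalence group).** Let $r\in\{2,3,\dots,\infty,\omega\}$ ($\omega$ meaning analytic), let $I,J,K\subseteq\mathbb R$ be non-empty open intervals and $\Omega=I\times J\times K$. Consider the class of equations $$u_t=[G(x)A(u)u_x]_x+W(t),\qquad t\in I,\ x\in J,\ u\in K,\tag{1}$$ where $A$, $G$, $W$ are arbitrary $C^r$ functions on $K$, $J$, $I$, and $A\not\equiv0$, $G\not\equiv0$. A point transformation is a $C^r$ diffeomorphism $\varphi:(t,x,u)\mapsto(\tilde t,\tilde x,\tilde u)$ of $\Omega$ onto an open subset of $\mathbb R^3$. It moves equation (1) to the equation $\tilde u_{\tilde t}=[\tilde G(\tilde x)\tilde A(\tilde u)\tilde u_{\tilde x}]_{\tilde x}+\tilde W(\tilde t)$ if the change of variables $\varphi$ turns the one equation into the other, that is, if its second prolongation identifies the two equations as subsets of the space of 2-jets over $\Omega$ and $\varphi(\Omega)$; here $\tilde A$, $\tilde G$, $\tilde W$ are $C^r$ functions on the ranges of $\tilde u$, $\tilde x$, $\tilde t$ over $\Omega$, with $\tilde A\not\equiv0$, $\tilde G\not\equiv0$. (i) A map $\varphi$ is a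 point transformation that moves every equation of the class to some equation of the class if and only if, on $\Omega$, $$\tilde t=\varepsilon_4t+\varepsilon_1,\quad \tilde x=\varepsilon_5x+\varepsilon_2,\quad \tilde u=\varepsilon_6u+\varepsilon_3$$ for some constants $\varepsilon_1,\dots,\varepsilon_6$ with $\varepsilon_4\varepsilon_5\varepsilon_6\ne0$. (ii) Such a transformation moves the equation with $(A,G,W)$ to the equation with $(\tilde A,\tilde G,\tilde W)$ if and only if there is a constant $\varepsilon_7\ne0$ such that $$\tilde A(\tilde u)=\varepsilon_7A(u),\quad \tilde G(\tilde x)=\varepsilon_4^{-1}\varepsilon_5^2\varepsilon_7^{-1}G(x),\quad \tilde W(\tilde t)=\varepsilon_4^{-1}\varepsilon_6W(t)$$ for all $(t,x,u)\in\Omega$. (iii) The equivalence group of the class, understood as the set of transformations of the variables together with the arbitrary elements, consists exactly of the transformations in (i) and (ii) with constants $\varepsilon_1,\dots,\varepsilon_7$: a point transformation $\varphi$ together with a map $(\tilde A,\tilde G,\tilde W)=F(t,x,u;A,G,W)$ of the values of the arbitrary elements moves every equation of the class to an equation of the class, the new elements being given by $F$, if and only if $\varphi$ is as in (i) and $F(t,x,u;a,g,w)=(\varepsilon_7a,\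 \varepsilon_4^{-1}\varepsilon_5^2\varepsilon_7^{-1}g,\ \varepsilon_4^{-1}\varepsilon_6w)$ on $\Omega\times\mathbb R^3$, for some constants with $\varepsilon_4\varepsilon_5\varepsilon_6\varepsilon_7\ne0$ that do not depend on the equation. -/

import Mathlib

open Set Filter Topology

namespace RadiantPlasma

/-- A triple `(A, G, W)` of arbitrary elements of the class
`u_t = [G(x) A(u) u_x]_x + W(t)`. -/
structure Elements where
  A : ℝ → ℝ
  G : ℝ → ℝ
  W : ℝ → ℝ

/-- The arbitrary elements are `C^r` on the ranges `I`, `J`, `K` of `t`, `x`, `u`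
(`r = ∞` is smooth, `r = ω` is analytic), and the diffusivity is not identically zero. -/
structure Elements.InClass (r : WithTop ℕ∞) (I J K : Set ℝ) (θ : Elements) : Prop where
  contDiffOn_A : ContDiffOn ℝ r θ.A K
  contDiffOn_G : ContDiffOn ℝ r θ.G J
  contDiffOn_W : ContDiffOn ℝ r θ.W I
  exists_A_ne_zero : ∃ u ∈ K, θ.A u ≠ 0
  exists_G_ne_zero : ∃ x ∈ J, θ.G x ≠ 0

/-- The function `u(t, x)` satisfies `u_t = [G(x) A(u) u_x]_x + W(t)` at the point `q = (t, x)`. -/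
def Elements.EquationAt (θ : Elements) (u : ℝ × ℝ → ℝ) (q : ℝ × ℝ) : Prop :=
  deriv (fun s => u (s, q.2)) q.1 =
    deriv (fun y => θ.G y * θ.A (u (q.1, y)) * deriv (fun z => u (q.1, z)) y) q.2 + θ.W q.1

/-- The box `I × J × K` of points `(t, x, u)`. -/
def box (I J K : Set ℝ) : Set (ℝ × ℝ × ℝ) := I ×ˢ J ×ˢ K

/-- A point transformation `(t, x, u) ↦ (t̃, x̃, ũ)` on the open set `Ω`: a `C^r` diffeomorphism
of `Ω` onto its image. All three new variables may depend on all three old ones. -/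
structure IsPointTransformation (r : WithTop ℕ∞) (Ω : Set (ℝ × ℝ × ℝ))
    (φ : ℝ × ℝ × ℝ → ℝ × ℝ × ℝ) : Prop where
  contDiffOn : ContDiffOn ℝ r φ Ω
  injOn : InjOn φ Ω
  isInvertible_fderiv : ∀ p ∈ Ω, (fderiv ℝ φ p).IsInvertible

/-- The point of the graph of `u` over `q = (t, x)`. -/
def graphPt (u : ℝ × ℝ → ℝ) (q : ℝ × ℝ) : ℝ × ℝ × ℝ := (q.1, q.2, u q)

/-- The independent variables `(t, x)` of `(t, x, u)`. -/
def base (p : ℝ × ℝ × ℝ) : ℝ × ℝ := (p.1, p.2.1)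

/-- The change of variables `φ` carries the equation with elements `θ` on `Ω` to the equation with
elements `θ'`: whenever, near a point `q = (t, x)`, the graph of a `C²` function `u` is carried by
`φ` into the graph of a `C²` function `v`, the function `u` satisfies the first equation at `q` if
and only if `v` satisfies the second one at the corresponding point. Since `u` is any function and
the equations are compared at a single point, this says that the second prolongation of `φ`
identifies the two equations as subsets of the space of 2-jets over `Ω`. -/
def MapsEquation (Ω : Set (ℝ × ℝ × ℝ)) (φ : ℝ × ℝ × ℝ → ℝ × ℝ × ℝ) (θ θ' : Elements) : Prop :=
  ∀ (u v : ℝ × ℝ → ℝ) (q : ℝ × ℝ), graphPt u q ∈ Ω →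
    ContDiffAt ℝ 2 u q → ContDiffAt ℝ 2 v (base (φ (graphPt u q))) →
    (∀ᶠ q' in 𝓝 q, v (base (φ (graphPt u q'))) = (φ (graphPt u q')).2.2) →
    (θ.EquationAt u q ↔ θ'.EquationAt v (base (φ (graphPt u q))))

/-- Membership in the class over the image `φ(Ω)`: the elements are regular on the ranges of the
new variables `t̃`, `x̃`, `ũ`. -/
def Elements.InImageClass (r : WithTop ℕ∞) (Ω : Set (ℝ × ℝ × ℝ))
    (φ : ℝ × ℝ × ℝ → ℝ × ℝ × ℝ) (θ : Elements) : Prop :=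
  θ.InClass r ((fun p => (φ p).1) '' Ω) ((fun p => (φ p).2.1) '' Ω) ((fun p => (φ p).2.2) '' Ω)

/-- A point transformation of `(t, x, u)` that moves every equation of the class to an equation
of the class. -/
def IsEquivalenceTransformation (r : WithTop ℕ∞) (I J K : Set ℝ)
    (φ : ℝ × ℝ × ℝ → ℝ × ℝ × ℝ) : Prop :=
  IsPointTransformation r (box I J K) φ ∧
    ∀ θ : Elements, θ.InClass r I J K →
      ∃ θ' : Elements, θ'.InImageClass r (box I J K) φ ∧ MapsEquation (box I J K) φ θ θ'

/-- A (usual) equivalence transformation together with its action on the arbitrary elements: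
a point transformation `φ` of `(t, x, u)` and a transformation
`(Ã, G̃, W̃) = F (t, x, u) (A, G, W)` of the values of the arbitrary elements, which together move
every equation of the class to an equation of the class. No regularity or invertibility of `F` is
demanded. -/
def IsExtendedEquivalenceTransformation (r : WithTop ℕ∞) (I J K : Set ℝ)
    (φ : ℝ × ℝ × ℝ → ℝ × ℝ × ℝ) (F : ℝ × ℝ × ℝ → ℝ × ℝ × ℝ → ℝ × ℝ × ℝ) : Prop :=
  IsPointTransformation r (box I J K) φ ∧
    ∀ θ : Elements, θ.InClass r I J K →
      ∃ θ' : Elements, θ'.InImageClass r (box I J K) φ ∧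
        (∀ p ∈ box I J K,
          (θ'.A (φ p).2.2, θ'.G (φ p).2.1, θ'.W (φ p).1) = F p (θ.A p.2.2, θ.G p.2.1, θ.W p.1)) ∧
        MapsEquation (box I J K) φ θ θ'

end RadiantPlasma

/-!
The group is determined by comparing second-order jets. Write `φ = (T, X, U)`. If `u₁` and `u₂`
agree at a point and `v₁`, `v₂` are their images under `φ`, then `v₂ - v₁` is to leading order
`u₂ - u₁`, read in the new independent variables and multiplied by a non-zero factor
(`image_sub_image_isLittleO`, `verticalFactor_ne_zero`). Two quadratic jets with the same tangent
plane therefore have images with the same first derivatives, and the change of `v_XX` is an explicit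
multiple of the quadratic form `u₂ - u₁` on the direction `t̃ = const` (`jetFn_image_derivs`). So the
coefficients of second derivatives in the two equations can be compared without ever expanding
the second prolongation (`MapsEquation.equationAt_jetFn_iff`).

The elements `A = G = 1`, `W = 0` give a great deal. Changing `u_tt` preserves the solutions of the
equation whereas changing `u_xx` does not; hence `D_x T = 0`, that is, `T = T(t)`. Comparing the
coefficients of `u_xx` then gives, for all elements of the class,
`G̃(X) Ã(U) T_t = G(x) A(u) (X_x + X_u u_x)²` (`MapsEquation.leading_coefficient`), which has no
`u_x` on the left, so `X_u = 0`. The freedom in the elements does the rest: taking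
`A = 1 + (u - u₀)²` forces `U = U(u)`, taking `G = 1 + (x - x₀)²` forces `X = X(x)`, and then `T_t`
is constant. Finally the linear functions `u = z + b (x - x₀)` solve the heat equation, and the flux
of their images is `X' U' b / T_t`. The images do not depend on `t̃`, so the `x̃`-derivative of the
flux is `-W̃`, whatever `b` is; this gives `X'' = U'' = 0` (`MapsEquation.deriv_deriv_eq_zero`).

For affine transformations the new equation is written in the old jet
(`IsAffineOn.equationAt_iff`) and the coefficients of `u_xx` and `1` are compared. The resulting
product identity `G̃ Ã = ε₄⁻¹ ε₅² G A` separates, with a constant `ε₇` that could depend on the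
equation. When the new elements are given by a map `F`, it cannot: two triples of elements that
agree at one point with `A ≠ 0` have the same `ε₇`, and linear functions interpolate between any
values at one point and the values `(1, 1, 0)` at another (`exists_inClass_interpolating`).
-/

namespace RadiantPlasma

/-! ### Calculus in one variable -/

theorem contDiffAt_deriv {h : ℝ → ℝ} {x : ℝ} (hh : ContDiffAt ℝ 2 h x) :
    ContDiffAt ℝ 1 (deriv h) x := by
  have h1 : ContDiffAt ℝ 1 (fderiv ℝ h) x := hh.fderiv_right (by norm_num)
  exact h1.clm_apply contDiffAt_const

theorem eventually_differentiableAt {E : Type*} [NormedAddCommGroup E] [NormedSpace ℝ E]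
    {h : E → ℝ} {x : E} (hh : ContDiffAt ℝ 2 h x) : ∀ᶠ y in 𝓝 x, DifferentiableAt ℝ h y :=
  (hh.eventually (by simp)).mono fun _ hy => hy.differentiableAt (by simp)

/-- A quadratic polynomial that is `o((s - x)²)` at `x` vanishes. -/
theorem eq_zero_of_quadratic_isLittleO {x c d e : ℝ}
    (ho : (fun s => c + d * (s - x) + e * (s - x) ^ 2) =o[𝓝 x] fun s => (s - x) ^ 2) :
    c = 0 ∧ d = 0 ∧ e = 0 := by
  have h0 : Tendsto (fun s : ℝ => s - x) (𝓝 x) (𝓝 0) := by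
    have : ContinuousAt (fun s : ℝ => s - x) x := by fun_prop
    simpa [ContinuousAt] using this
  have hc : c = 0 := by
    have h2 : Tendsto (fun s : ℝ => (s - x) ^ 2) (𝓝 x) (𝓝 0) := by simpa using h0.pow 2
    have h1 := ho.trans_tendsto h2
    have h3 : Tendsto (fun s : ℝ => c + d * (s - x) + e * (s - x) ^ 2) (𝓝 x) (𝓝 c) := by
      simpa using ((h0.const_mul d).const_add c).add (h2.const_mul e)
    exact tendsto_nhds_unique h3 h1
  subst hc
  have h1 := (ho.mono (nhdsWithin_le_nhds (s := {x}ᶜ))).tendsto_div_nhds_zero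
  have h0' : Tendsto (fun s : ℝ => s - x) (𝓝[≠] x) (𝓝 0) := h0.mono_left nhdsWithin_le_nhds
  have hd : d = 0 := by
    have h2 : Tendsto (fun s : ℝ => (s - x) * ((0 + d * (s - x) + e * (s - x) ^ 2) / (s - x) ^ 2))
        (𝓝[≠] x) (𝓝 0) := by simpa using h0'.mul h1
    have h3 : Tendsto (fun s : ℝ => d + e * (s - x)) (𝓝[≠] x) (𝓝 d) := by
      simpa using (h0'.const_mul e).const_add d
    refine tendsto_nhds_unique (h3.congr' ?_) h2
    filter_upwards [self_mem_nhdsWithin] with s hs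
    have : s - x ≠ 0 := sub_ne_zero.2 hs
    field_simp
    ring
  subst hd
  refine ⟨rfl, rfl, ?_⟩
  refine tendsto_nhds_unique (f := fun _ : ℝ => e) tendsto_const_nhds (h1.congr' ?_)
  filter_upwards [self_mem_nhdsWithin] with s hs
  have : s - x ≠ 0 := sub_ne_zero.2 hs
  field_simp
  ring

/-- Uniqueness of the second Taylor polynomial. -/
theorem derivs_eq_of_isLittleO {h : ℝ → ℝ} {x κ : ℝ} (hh : ContDiffAt ℝ 2 h x)
    (ho : (fun s => h s - κ * (s - x) ^ 2) =o[𝓝 x] fun s => (s - x) ^ 2) :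
    deriv h x = 0 ∧ deriv (deriv h) x = 2 * κ := by
  obtain ⟨ε, hε, hball⟩ := Metric.eventually_nhds_iff_ball.1 (eventually_differentiableAt hh)
  have hd2 : HasDerivAt (deriv h) (deriv (deriv h) x) x :=
    ((contDiffAt_deriv hh).differentiableAt (by simp)).hasDerivAt
  set m := deriv (deriv h) x
  have hT : (fun s => (h s - deriv h x * (s - x) - m / 2 * (s - x) ^ 2) - h x) =o[𝓝 x]
      fun s => (s - x) ^ 2 := by
    have := (convex_ball x ε).isLittleO_pow_succ_real (n := 1) (x₀ := x)
      (f := fun s => h s - deriv h x * (s - x) - m / 2 * (s - x) ^ 2)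
      (f' := fun s => deriv h s - deriv h x - m * (s - x)) (Metric.mem_ball_self hε) ?_ ?_
    · simpa [nhdsWithin_eq_nhds.2 (Metric.ball_mem_nhds x hε)] using this
    · intro s hs
      have e1 : HasDerivAt (fun s => s - x) 1 s := (hasDerivAt_id s).sub_const x
      have e2 := ((hball s hs).hasDerivAt.sub (e1.const_mul (deriv h x))).sub
        ((e1.pow 2).const_mul (m / 2))
      refine HasDerivAt.hasDerivWithinAt (e2.congr_deriv ?_)
      push_cast
      ring
    · rw [nhdsWithin_eq_nhds.2 (Metric.ball_mem_nhds x hε)]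
      have := hasDerivAt_iff_isLittleO.1 hd2
      simpa [mul_comm] using this
  have hsum := ho.sub hT
  have hq : (fun s => h x + deriv h x * (s - x) + (m / 2 - κ) * (s - x) ^ 2) =o[𝓝 x]
      fun s => (s - x) ^ 2 := by
    refine hsum.congr_left fun s => ?_
    ring
  obtain ⟨-, h1, h2⟩ := eq_zero_of_quadratic_isLittleO hq
  exact ⟨h1, by linarith⟩

theorem exists_eq_mul_add {S : Set ℝ} (hS : IsOpen S) (hS' : S.OrdConnected) {f : ℝ → ℝ} {c : ℝ}
    (hf : ∀ x ∈ S, HasDerivAt f c x) : ∃ d, ∀ x ∈ S, f x = c * x + d := by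
  have hd : ∀ x ∈ S, HasDerivAt (fun x => f x - c * x) 0 x := fun x hx =>
    ((hf x hx).sub ((hasDerivAt_id x).const_mul c)).congr_deriv (by simp)
  obtain ⟨d, hd'⟩ := hS.exists_is_const_of_deriv_eq_zero hS'.isPreconnected
    (fun x hx => (hd x hx).differentiableAt.differentiableWithinAt) (fun x hx => (hd x hx).deriv)
  exact ⟨d, fun x hx => by linarith [hd' x hx]⟩

/-! ### The equation in terms of the 2-jet -/

theorem Elements.equationAt_iff {θ : Elements} {v : ℝ × ℝ → ℝ} {q : ℝ × ℝ}
    (hv : ContDiffAt ℝ 2 v q) (hG : DifferentiableAt ℝ θ.G q.2)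
    (hA : DifferentiableAt ℝ θ.A (v q)) :
    θ.EquationAt v q ↔ deriv (fun s => v (s, q.2)) q.1 =
      deriv θ.G q.2 * θ.A (v q) * deriv (fun z => v (q.1, z)) q.2 +
      θ.G q.2 * deriv θ.A (v q) * deriv (fun z => v (q.1, z)) q.2 ^ 2 +
      θ.G q.2 * θ.A (v q) * deriv (deriv fun z => v (q.1, z)) q.2 + θ.W q.1 := by
  have hk : ContDiffAt ℝ 2 (fun z => v (q.1, z)) q.2 :=
    ContDiffAt.comp q.2 (f := fun z => (q.1, z)) hv (by fun_prop)
  have h1 : HasDerivAt (fun z => v (q.1, z)) _ q.2 := (hk.differentiableAt (by simp)).hasDerivAt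
  have h2 := ((contDiffAt_deriv hk).differentiableAt (by simp)).hasDerivAt
  have h3 : HasDerivAt (fun z => θ.A (v (q.1, z))) _ q.2 :=
    HasDerivAt.comp q.2 (h₂ := θ.A) (h := fun z => v (q.1, z)) hA.hasDerivAt h1
  have h4 : HasDerivAt (fun z => θ.G z * θ.A (v (q.1, z)) * deriv (fun z => v (q.1, z)) z) _ q.2 :=
    (hG.hasDerivAt.mul h3).mul h2
  unfold Elements.EquationAt
  rw [h4.deriv]
  constructor <;> intro h <;> rw [h] <;> simp only [Prod.mk.eta, Pi.mul_apply] <;> ring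

/-- The quadratic polynomial with value `z`, slopes `a`, `b` in `t`, `x` and pure second
derivatives `2m`, `2c` at `q`. -/
def jetFn (q : ℝ × ℝ) (z a b m c : ℝ) (q' : ℝ × ℝ) : ℝ :=
  z + a * (q'.1 - q.1) + b * (q'.2 - q.2) + m * (q'.1 - q.1) ^ 2 + c * (q'.2 - q.2) ^ 2

section jetFn

variable (q : ℝ × ℝ) (z a b m c : ℝ)

@[simp]
theorem jetFn_self : jetFn q z a b m c q = z := by simp [jetFn]

theorem contDiff_jetFn {n : WithTop ℕ∞} : ContDiff ℝ n (jetFn q z a b m c) := by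
  unfold jetFn
  fun_prop

theorem hasFDerivAt_jetFn : HasFDerivAt (jetFn q z a b m c)
    (a • ContinuousLinearMap.fst ℝ ℝ ℝ + b • ContinuousLinearMap.snd ℝ ℝ ℝ) q := by
  have h1 : HasFDerivAt (fun q' : ℝ × ℝ => q'.1 - q.1) (ContinuousLinearMap.fst ℝ ℝ ℝ) q :=
    hasFDerivAt_fst.sub_const _
  have h2 : HasFDerivAt (fun q' : ℝ × ℝ => q'.2 - q.2) (ContinuousLinearMap.snd ℝ ℝ ℝ) q :=
    hasFDerivAt_snd.sub_const _
  have := ((((h1.const_mul a).const_add z).add (h2.const_mul b)).add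
    ((h1.pow 2).const_mul m)).add ((h2.pow 2).const_mul c)
  refine this.congr_fderiv ?_
  ext <;> simp

theorem deriv_jetFn_snd (y : ℝ) :
    deriv (fun y => jetFn q z a b m c (q.1, y)) y = b + 2 * c * (y - q.2) := by
  have e1 : HasDerivAt (fun s => s - q.2) 1 y := (hasDerivAt_id y).sub_const q.2
  have := ((e1.const_mul b).const_add z).add ((e1.pow 2).const_mul c)
  have h2 : HasDerivAt (fun y => jetFn q z a b m c (q.1, y)) (b + 2 * c * (y - q.2)) y := by
    refine (this.congr_deriv ?_).congr_of_eventuallyEq (Eventually.of_forall fun s => ?_)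
    · push_cast
      ring
    · simp [jetFn]
  exact h2.deriv

theorem deriv_jetFn_fst : deriv (fun s => jetFn q z a b m c (s, q.2)) q.1 = a := by
  have h := (hasFDerivAt_jetFn q z a b m c).comp_hasDerivAt q.1
    (f := fun s : ℝ => (s, q.2)) ((hasDerivAt_id q.1).prodMk (hasDerivAt_const _ _))
  have h' : HasDerivAt (fun s => jetFn q z a b m c (s, q.2)) _ q.1 := h
  rw [h'.deriv]
  simp

theorem Elements.equationAt_jetFn {θ : Elements}
    (hG : DifferentiableAt ℝ θ.G q.2) (hA : DifferentiableAt ℝ θ.A z) :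
    θ.EquationAt (jetFn q z a b m c) q ↔ a =
      deriv θ.G q.2 * θ.A z * b + θ.G q.2 * deriv θ.A z * b ^ 2 +
      θ.G q.2 * θ.A z * (2 * c) + θ.W q.1 := by
  rw [Elements.equationAt_iff (contDiff_jetFn q z a b m c).contDiffAt hG (by simpa using hA),
    deriv_jetFn_fst]
  have : deriv (fun y => jetFn q z a b m c (q.1, y)) = fun y => b + 2 * c * (y - q.2) :=
    funext fun y => deriv_jetFn_snd q z a b m c y
  have h2 : deriv (fun y => b + 2 * c * (y - q.2)) q.2 = 2 * c := by
    simp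
  rw [this, h2]
  simp

end jetFn

/-! ### Transport of graphs by a point transformation -/

/-- The linear map `(t, x, u) ↦ (t, x)` underlying `base`. -/
def baseL : ℝ × ℝ × ℝ →L[ℝ] ℝ × ℝ :=
  (ContinuousLinearMap.fst ℝ ℝ (ℝ × ℝ)).prod
    ((ContinuousLinearMap.fst ℝ ℝ ℝ).comp (ContinuousLinearMap.snd ℝ ℝ (ℝ × ℝ)))

/-- The linear graph map `(t, x) ↦ (t, x, d (t, x))`. -/
def graphL (d : ℝ × ℝ →L[ℝ] ℝ) : ℝ × ℝ →L[ℝ] ℝ × ℝ × ℝ :=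
  (ContinuousLinearMap.fst ℝ ℝ ℝ).prod ((ContinuousLinearMap.snd ℝ ℝ ℝ).prod d)

@[simp]
theorem baseL_apply (p : ℝ × ℝ × ℝ) : baseL p = base p := rfl

@[simp]
theorem graphL_apply (d : ℝ × ℝ →L[ℝ] ℝ) (q : ℝ × ℝ) : graphL d q = (q.1, q.2, d q) := rfl

theorem contDiff_base {n : WithTop ℕ∞} : ContDiff ℝ n base := baseL.contDiff

theorem hasFDerivAt_base (p : ℝ × ℝ × ℝ) : HasFDerivAt base baseL p := baseL.hasFDerivAt

theorem hasFDerivAt_graphPt {u : ℝ × ℝ → ℝ} {q : ℝ × ℝ} {d : ℝ × ℝ →L[ℝ] ℝ}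
    (hu : HasFDerivAt u d q) : HasFDerivAt (graphPt u) (graphL d) q :=
  hasFDerivAt_fst.prodMk (hasFDerivAt_snd.prodMk hu)

theorem contDiffAt_graphPt {u : ℝ × ℝ → ℝ} {q : ℝ × ℝ} (hu : ContDiffAt ℝ 2 u q) :
    ContDiffAt ℝ 2 (graphPt u) q :=
  contDiffAt_fst.prodMk (contDiffAt_snd.prodMk hu)

/-- Near the point over `q`, the graph of `u` is carried by `φ` into the graph of `v`. -/
def IsImageAt (φ : ℝ × ℝ × ℝ → ℝ × ℝ × ℝ) (u v : ℝ × ℝ → ℝ) (q : ℝ × ℝ) : Prop :=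
  ∀ᶠ q' in 𝓝 q, v (base (φ (graphPt u q'))) = (φ (graphPt u q')).2.2

section transport

variable {φ : ℝ × ℝ × ℝ → ℝ × ℝ × ℝ} {D : ℝ × ℝ × ℝ →L[ℝ] ℝ × ℝ × ℝ} {q : ℝ × ℝ}
  {d : ℝ × ℝ →L[ℝ] ℝ} {e : (ℝ × ℝ) ≃L[ℝ] ℝ × ℝ}

theorem hasFDerivAt_base_comp {u : ℝ × ℝ → ℝ} (hD : HasFDerivAt φ D (graphPt u q))
    (hd : HasFDerivAt u d q) (he : ∀ y, e y = base (D (graphL d y))) :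
    HasFDerivAt (fun q' => base (φ (graphPt u q'))) (e : ℝ × ℝ →L[ℝ] ℝ × ℝ) q := by
  have h : HasFDerivAt (fun q' => base (φ (graphPt u q'))) (baseL.comp (D.comp (graphL d))) q :=
    (hasFDerivAt_base _).comp q (hD.comp q (hasFDerivAt_graphPt hd))
  refine h.congr_fderiv (ContinuousLinearMap.ext fun y => ?_)
  exact (he y).symm

/-- The local inverse of the change of independent variables along the graph of `u`. -/
theorem exists_local_inverse {u : ℝ × ℝ → ℝ} (hφ : ContDiffAt ℝ 2 φ (graphPt u q))
    (hD : HasFDerivAt φ D (graphPt u q)) (hu : ContDiffAt ℝ 2 u q)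
    (hd : HasFDerivAt u d q) (he : ∀ y, e y = base (D (graphL d y))) :
    ∃ χ : ℝ × ℝ → ℝ × ℝ, ContDiffAt ℝ 2 χ (base (φ (graphPt u q))) ∧
      HasFDerivAt χ (e.symm : ℝ × ℝ →L[ℝ] ℝ × ℝ) (base (φ (graphPt u q))) ∧
      χ (base (φ (graphPt u q))) = q ∧
      (∀ᶠ y in 𝓝 (base (φ (graphPt u q))), base (φ (graphPt u (χ y))) = y) ∧
      ∀ᶠ q' in 𝓝 q, χ (base (φ (graphPt u q'))) = q' := by
  have hψ : ContDiffAt ℝ 2 (fun q' => base (φ (graphPt u q'))) q :=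
    contDiff_base.contDiffAt.comp q (hφ.comp q (contDiffAt_graphPt hu))
  have hψ' := hasFDerivAt_base_comp hD hd he
  have hs := hψ.hasStrictFDerivAt' hψ' (by simp)
  exact ⟨hs.localInverse _ _ _, hψ.to_localInverse hψ' (by simp),
    hs.to_localInverse.hasFDerivAt, hs.localInverse_apply_image, hs.eventually_right_inverse,
    hs.eventually_left_inverse⟩

/-- A graph along which the new independent variables are local coordinates has an image. -/
theorem exists_image {u : ℝ × ℝ → ℝ} (hφ : ContDiffAt ℝ 2 φ (graphPt u q))
    (hD : HasFDerivAt φ D (graphPt u q)) (hu : ContDiffAt ℝ 2 u q)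
    (hd : HasFDerivAt u d q) (he : ∀ y, e y = base (D (graphL d y))) :
    ∃ v, ContDiffAt ℝ 2 v (base (φ (graphPt u q))) ∧ IsImageAt φ u v q := by
  obtain ⟨χ, h1, -, h3, -, h5⟩ := exists_local_inverse hφ hD hu hd he
  refine ⟨fun y => (φ (graphPt u (χ y))).2.2, ?_, h5.mono fun q' hq' => by simp only [hq']⟩
  have hφu : ContDiffAt ℝ 2 (fun q' => φ (graphPt u q')) (χ (base (φ (graphPt u q)))) := by
    rw [h3]
    exact hφ.comp q (contDiffAt_graphPt hu)
  exact contDiffAt_snd.comp _ (contDiffAt_snd.comp _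
    (ContDiffAt.comp (base (φ (graphPt u q))) (g := fun q' => φ (graphPt u q')) hφu h1))

/-- The factor `U_u - v_T T_u - v_X X_u` by which a small vertical displacement of the graph of
`u` is multiplied when it is seen as a vertical displacement of the graph of the image `v`. -/
noncomputable def verticalFactor (D : ℝ × ℝ × ℝ →L[ℝ] ℝ × ℝ × ℝ) (v : ℝ × ℝ → ℝ) (y : ℝ × ℝ) : ℝ :=
  (D (0, 0, 1)).2.2 - fderiv ℝ v y (base (D (0, 0, 1)))

theorem verticalFactor_ne_zero {u v : ℝ × ℝ → ℝ} (hD : HasFDerivAt φ D (graphPt u q))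
    (hsurj : Function.Surjective D) (hd : HasFDerivAt u d q)
    (hv : DifferentiableAt ℝ v (base (φ (graphPt u q)))) (h : IsImageAt φ u v q) :
    verticalFactor D v (base (φ (graphPt u q))) ≠ 0 := by
  set y := base (φ (graphPt u q))
  have hg := hD.comp q (hasFDerivAt_graphPt hd)
  have h1 : HasFDerivAt (fun q' => v (base (φ (graphPt u q'))))
      ((fderiv ℝ v y).comp (baseL.comp (D.comp (graphL d)))) q :=
    HasFDerivAt.comp q (g := v) hv.hasFDerivAt ((hasFDerivAt_base _).comp q hg)
  have h2 : HasFDerivAt (fun q' => (φ (graphPt u q')).2.2)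
      ((ContinuousLinearMap.snd ℝ ℝ ℝ).comp ((ContinuousLinearMap.snd ℝ ℝ (ℝ × ℝ)).comp
        (D.comp (graphL d)))) q :=
    hasFDerivAt_snd.comp q (hasFDerivAt_snd.comp q hg)
  have h3 := h1.unique (h2.congr_of_eventuallyEq h)
  -- the covector `dU - v_T dT - v_X dX` kills the graph directions
  have h4 : ∀ y', fderiv ℝ v y (base (D (graphL d y'))) = (D (graphL d y')).2.2 := fun y' =>
    DFunLike.congr_fun h3 y'
  intro h0
  have h5 : ∀ p, (D p).2.2 = fderiv ℝ v y (base (D p)) := by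
    intro p
    have hp : p = graphL d (p.1, p.2.1) + (p.2.2 - d (p.1, p.2.1)) • ((0, 0, 1) : ℝ × ℝ × ℝ) := by
      ext <;> simp
    have h6 : (D (0, 0, 1)).2.2 = fderiv ℝ v y (base (D (0, 0, 1))) := sub_eq_zero.1 h0
    rw [hp, map_add, map_smul, ← baseL_apply, map_add, map_smul, map_add, map_smul, baseL_apply,
      baseL_apply, h4, ← h6]
    simp
  obtain ⟨p, hp⟩ := hsurj (0, 0, 1)
  have := h5 p
  rw [hp, show base (0, 0, 1) = 0 from rfl, map_zero] at this
  exact one_ne_zero this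

/-- If the graphs of `u₁` and `u₂` meet over `q`, the difference of their images is, to leading
order, the difference of `u₁` and `u₂` times the vertical factor, read in the new independent
variables. -/
theorem image_sub_image_isLittleO {u₁ u₂ v₁ v₂ : ℝ × ℝ → ℝ}
    (hφ : ContDiffAt ℝ 2 φ (graphPt u₂ q)) (hD : HasFDerivAt φ D (graphPt u₂ q))
    (hu₁ : ContinuousAt u₁ q) (hu₂ : ContDiffAt ℝ 2 u₂ q) (hu : u₁ q = u₂ q)
    (hv₁ : ContDiffAt ℝ 2 v₁ (base (φ (graphPt u₂ q))))
    (h₁ : IsImageAt φ u₁ v₁ q) (h₂ : IsImageAt φ u₂ v₂ q)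
    {χ : ℝ × ℝ → ℝ × ℝ} (hχc : ContinuousAt χ (base (φ (graphPt u₂ q))))
    (hχq : χ (base (φ (graphPt u₂ q))) = q)
    (hχ : ∀ᶠ y in 𝓝 (base (φ (graphPt u₂ q))), base (φ (graphPt u₂ (χ y))) = y) :
    (fun y => v₂ y - v₁ y -
        verticalFactor D v₁ (base (φ (graphPt u₂ q))) * (u₂ (χ y) - u₁ (χ y)))
      =o[𝓝 (base (φ (graphPt u₂ q)))] fun y => u₂ (χ y) - u₁ (χ y) := by
  set p := graphPt u₂ q with hp
  set y₀ := base (φ p) with hy₀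
  have hχt : Tendsto χ (𝓝 y₀) (𝓝 q) := by
    have : Tendsto χ (𝓝 y₀) (𝓝 (χ y₀)) := hχc
    rwa [hχq] at this
  -- `E` vanishes on the graph of `u₁`, and its `u`-derivative is the vertical factor
  let E : ℝ × ℝ × ℝ → ℝ := fun p => (φ p).2.2 - v₁ (base (φ p))
  have hE : ContDiffAt ℝ 2 E p :=
    (contDiffAt_snd.comp p (contDiffAt_snd.comp p hφ)).sub
      (ContDiffAt.comp p (g := v₁) hv₁ (contDiff_base.contDiffAt.comp p hφ))
  have hE' : HasFDerivAt E ((ContinuousLinearMap.snd ℝ ℝ ℝ).comp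
      ((ContinuousLinearMap.snd ℝ ℝ (ℝ × ℝ)).comp D) -
        (fderiv ℝ v₁ y₀).comp (baseL.comp D)) p :=
    (hasFDerivAt_snd.comp p (hasFDerivAt_snd.comp p hD)).sub
      (HasFDerivAt.comp p (g := v₁) (hv₁.differentiableAt (by simp)).hasFDerivAt
        ((hasFDerivAt_base _).comp p hD))
  have hs := (hE.hasStrictFDerivAt' hE' (by simp)).isLittleO
  have ht : Tendsto (fun y => (graphPt u₂ (χ y), graphPt u₁ (χ y))) (𝓝 y₀) (𝓝 (p, p)) := by
    have c₁ : ContinuousAt (graphPt u₁) q :=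
      continuousAt_fst.prodMk (continuousAt_snd.prodMk hu₁)
    have c₂ : ContinuousAt (graphPt u₂) q :=
      continuousAt_fst.prodMk (continuousAt_snd.prodMk hu₂.continuousAt)
    have e : graphPt u₁ q = p := by simp [hp, graphPt, hu]
    have c₁' : Tendsto (graphPt u₁) (𝓝 q) (𝓝 p) := e ▸ c₁
    exact ((Tendsto.comp c₂ hχt).prodMk_nhds (c₁'.comp hχt))
  have hmain := hs.comp_tendsto ht
  have hv : ∀ y, graphPt u₂ (χ y) - graphPt u₁ (χ y) =
      (u₂ (χ y) - u₁ (χ y)) • ((0, 0, 1) : ℝ × ℝ × ℝ) := fun y => by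
    ext <;> simp [graphPt]
  refine (hmain.congr' ?_ EventuallyEq.rfl).trans_isBigO ?_
  · filter_upwards [hχ, hχt.eventually h₁, hχt.eventually h₂] with y e0 e1 e2
    simp only [Function.comp_apply, hv, map_smul, E, e1, sub_self, ← e2, e0]
    simp [verticalFactor, mul_comm]
  · refine Asymptotics.IsBigO.of_bound 1 (Eventually.of_forall fun y => ?_)
    simp only [Function.comp_apply, hv, norm_smul, one_mul]
    have : ‖((0, 0, 1) : ℝ × ℝ × ℝ)‖ = 1 := by simp [Prod.norm_def]
    rw [this, mul_one]

end transport

/-! ### Comparison of two jets with the same tangent plane -/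

/-- The linear form with slopes `a`, `b`. -/
def slopeL (a b : ℝ) : ℝ × ℝ →L[ℝ] ℝ :=
  a • ContinuousLinearMap.fst ℝ ℝ ℝ + b • ContinuousLinearMap.snd ℝ ℝ ℝ

@[simp]
theorem slopeL_apply (a b : ℝ) (y : ℝ × ℝ) : slopeL a b y = a * y.1 + b * y.2 := by
  simp [slopeL]

/-- The Jacobian determinant of the new independent variables along a graph with slopes `a`, `b`. -/
def baseJacobian (D : ℝ × ℝ × ℝ →L[ℝ] ℝ × ℝ × ℝ) (a b : ℝ) : ℝ :=
  (D (1, 0, a)).1 * (D (0, 1, b)).2.1 - (D (0, 1, b)).1 * (D (1, 0, a)).2.1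

theorem apply_graphL_slopeL (D : ℝ × ℝ × ℝ →L[ℝ] ℝ × ℝ × ℝ) (a b : ℝ) (y : ℝ × ℝ) :
    D (graphL (slopeL a b) y) = y.1 • D (1, 0, a) + y.2 • D (0, 1, b) := by
  rw [← map_smul, ← map_smul, ← map_add]
  congr 1
  ext <;> simp
  ring

theorem exists_equiv_of_baseJacobian_ne_zero {D : ℝ × ℝ × ℝ →L[ℝ] ℝ × ℝ × ℝ} {a b : ℝ}
    (h : baseJacobian D a b ≠ 0) :
    ∃ e : (ℝ × ℝ) ≃L[ℝ] ℝ × ℝ, (∀ y, e y = base (D (graphL (slopeL a b) y))) ∧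
      (e.symm (1, 0)).1 = (D (0, 1, b)).2.1 / baseJacobian D a b ∧
      (e.symm (0, 1)).1 = -(D (0, 1, b)).1 / baseJacobian D a b ∧
      (e.symm (0, 1)).2 = (D (1, 0, a)).1 / baseJacobian D a b := by
  set J := baseJacobian D a b with hJ
  let B : ℝ × ℝ →L[ℝ] ℝ × ℝ :=
    (slopeL ((D (0, 1, b)).2.1 / J) (-(D (0, 1, b)).1 / J)).prod
      (slopeL (-(D (1, 0, a)).2.1 / J) ((D (1, 0, a)).1 / J))
  have hf : ∀ y, (baseL.comp (D.comp (graphL (slopeL a b)))) y =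
      (y.1 * (D (1, 0, a)).1 + y.2 * (D (0, 1, b)).1,
        y.1 * (D (1, 0, a)).2.1 + y.2 * (D (0, 1, b)).2.1) := fun y => by
    simp only [ContinuousLinearMap.comp_apply, apply_graphL_slopeL]
    rfl
  have hB : ∀ y, B y = ((D (0, 1, b)).2.1 / J * y.1 + -(D (0, 1, b)).1 / J * y.2,
      -(D (1, 0, a)).2.1 / J * y.1 + (D (1, 0, a)).1 / J * y.2) := fun y => by
    simp [B]
  refine ⟨ContinuousLinearEquiv.equivOfInverse (baseL.comp (D.comp (graphL (slopeL a b)))) B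
    (fun y => ?_) (fun y => ?_), fun y => rfl, ?_, ?_, ?_⟩
  · rw [hB, hf]
    ext <;> simp only <;> field_simp <;> rw [hJ, baseJacobian] <;> ring
  · rw [hf, hB]
    ext <;> simp only <;> field_simp <;> rw [hJ, baseJacobian] <;> ring
  · change (B (1, 0)).1 = _
    simp [hB]
  · change (B (0, 1)).1 = _
    simp [hB]
  · change (B (0, 1)).2 = _
    simp [hB]

theorem sq_sub_isLittleO {f : ℝ → ℝ} {x β : ℝ} (hf : HasDerivAt f β x) :
    (fun s => (f s - f x) ^ 2 - β ^ 2 * (s - x) ^ 2) =o[𝓝 x] fun s => (s - x) ^ 2 := by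
  have h1 := hasDerivAt_iff_isLittleO.1 hf
  have h2 : (fun s => f s - f x + β * (s - x)) =O[𝓝 x] fun s => s - x :=
    hf.isBigO_sub.add ((Asymptotics.isBigO_refl _ _).const_mul_left β)
  refine (h1.mul_isBigO h2).congr (fun s => ?_) (fun s => ?_)
  · simp only [smul_eq_mul]
    ring
  · ring

section jets

variable {φ : ℝ × ℝ × ℝ → ℝ × ℝ × ℝ} {D : ℝ × ℝ × ℝ →L[ℝ] ℝ × ℝ × ℝ} {q : ℝ × ℝ} {z : ℝ}

@[simp]
theorem graphPt_jetFn (a b m c : ℝ) : graphPt (jetFn q z a b m c) q = (q.1, q.2, z) := by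
  simp [graphPt]

/-- How the image of a quadratic jet changes when the slope in `t` and the pure second derivatives
of the jet are changed. The hypothesis `hα` says that a change of the slope in `t` is not seen
along the curve on which `t̃` is constant. -/
theorem jetFn_image_derivs (hφ : ContDiffAt ℝ 2 φ (q.1, q.2, z))
    (hD : HasFDerivAt φ D (q.1, q.2, z)) {y₀ : ℝ × ℝ} (hy₀ : y₀ = base (φ (q.1, q.2, z)))
    {a₁ a₂ b m₁ m₂ c₁ c₂ : ℝ} {v₁ v₂ : ℝ × ℝ → ℝ} {e : (ℝ × ℝ) ≃L[ℝ] ℝ × ℝ}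
    (he : ∀ y, e y = base (D (graphL (slopeL a₂ b) y)))
    (hv₁ : ContDiffAt ℝ 2 v₁ y₀) (hv₂ : ContDiffAt ℝ 2 v₂ y₀)
    (h₁ : IsImageAt φ (jetFn q z a₁ b m₁ c₁) v₁ q)
    (h₂ : IsImageAt φ (jetFn q z a₂ b m₂ c₂) v₂ q)
    (hα : ∀ χ : ℝ × ℝ → ℝ × ℝ, ContinuousAt χ y₀ → χ y₀ = q →
      (∀ᶠ y in 𝓝 y₀, base (φ (graphPt (jetFn q z a₂ b m₂ c₂) (χ y))) = y) →
      ∀ᶠ s in 𝓝 y₀.2, (a₂ - a₁) * ((χ (y₀.1, s)).1 - q.1) = 0) :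
    deriv (fun s => v₂ (s, y₀.2)) y₀.1 = deriv (fun s => v₁ (s, y₀.2)) y₀.1 +
        verticalFactor D v₁ y₀ * ((a₂ - a₁) * (e.symm (1, 0)).1) ∧
      deriv (fun s => v₂ (y₀.1, s)) y₀.2 = deriv (fun s => v₁ (y₀.1, s)) y₀.2 ∧
      deriv (deriv fun s => v₂ (y₀.1, s)) y₀.2 = deriv (deriv fun s => v₁ (y₀.1, s)) y₀.2 +
        verticalFactor D v₁ y₀ * (2 * ((m₂ - m₁) * (e.symm (0, 1)).1 ^ 2 +
          (c₂ - c₁) * (e.symm (0, 1)).2 ^ 2)) := by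
  have hu₂ : ContDiffAt ℝ 2 (jetFn q z a₂ b m₂ c₂) q := (contDiff_jetFn ..).contDiffAt
  obtain ⟨χ, hχ2, hχd, hχq, hχr, -⟩ := exists_local_inverse (by simpa using hφ) (by simpa using hD)
    hu₂ (hasFDerivAt_jetFn ..) he
  have hmain := image_sub_image_isLittleO (by simpa using hφ) (by simpa using hD)
    (contDiff_jetFn (n := 0) q z a₁ b m₁ c₁).continuous.continuousAt hu₂ (by simp)
    (by simpa [← hy₀] using hv₁) h₁ h₂ hχ2.continuousAt hχq hχr
  simp only [graphPt_jetFn, ← hy₀] at hχ2 hχd hχq hχr hmain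
  set η := verticalFactor D v₁ y₀
  have hw : ∀ q', jetFn q z a₂ b m₂ c₂ q' - jetFn q z a₁ b m₁ c₁ q' =
      (a₂ - a₁) * (q'.1 - q.1) + (m₂ - m₁) * (q'.1 - q.1) ^ 2 +
        (c₂ - c₁) * (q'.2 - q.2) ^ 2 := fun q' => by
    simp only [jetFn]
    ring
  simp only [hw] at hmain
  -- the curves `t̃ ↦ (t̃, y₀.2)` and `x̃ ↦ (y₀.1, x̃)`
  have lT : HasDerivAt (fun s : ℝ => (s, y₀.2)) (1, 0) y₀.1 :=
    (hasDerivAt_id _).prodMk (hasDerivAt_const _ _)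
  have lX : HasDerivAt (fun s : ℝ => (y₀.1, s)) (0, 1) y₀.2 :=
    (hasDerivAt_const _ _).prodMk (hasDerivAt_id _)
  have χT : HasDerivAt (fun s : ℝ => χ (s, y₀.2)) (e.symm (1, 0)) y₀.1 :=
    HasFDerivAt.comp_hasDerivAt y₀.1 (l := χ) (f := fun s : ℝ => (s, y₀.2)) hχd lT
  have χX : HasDerivAt (fun s : ℝ => χ (y₀.1, s)) (e.symm (0, 1)) y₀.2 :=
    HasFDerivAt.comp_hasDerivAt y₀.2 (l := χ) (f := fun s : ℝ => (y₀.1, s)) hχd lX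
  have k₁T : DifferentiableAt ℝ (fun s => v₁ (s, y₀.2)) y₀.1 :=
    DifferentiableAt.comp y₀.1 (g := v₁) (hv₁.differentiableAt (by simp)) lT.differentiableAt
  have k₂T : DifferentiableAt ℝ (fun s => v₂ (s, y₀.2)) y₀.1 :=
    DifferentiableAt.comp y₀.1 (g := v₂) (hv₂.differentiableAt (by simp)) lT.differentiableAt
  have k₁X : ContDiffAt ℝ 2 (fun s => v₁ (y₀.1, s)) y₀.2 :=
    ContDiffAt.comp y₀.2 (g := v₁) hv₁ (by fun_prop)
  have k₂X : ContDiffAt ℝ 2 (fun s => v₂ (y₀.1, s)) y₀.2 :=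
    ContDiffAt.comp y₀.2 (g := v₂) hv₂ (by fun_prop)
  refine ⟨?_, ?_⟩
  · have t1 : HasDerivAt (fun s => (χ (s, y₀.2)).1 - q.1) (e.symm (1, 0)).1 y₀.1 :=
      (HasFDerivAt.comp_hasDerivAt y₀.1 (f := fun s => χ (s, y₀.2)) hasFDerivAt_fst χT).sub_const _
    have t2 : HasDerivAt (fun s => (χ (s, y₀.2)).2 - q.2) (e.symm (1, 0)).2 y₀.1 :=
      (HasFDerivAt.comp_hasDerivAt y₀.1 (f := fun s => χ (s, y₀.2)) hasFDerivAt_snd χT).sub_const _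
    have hW : HasDerivAt (fun s => (a₂ - a₁) * ((χ (s, y₀.2)).1 - q.1) +
        (m₂ - m₁) * ((χ (s, y₀.2)).1 - q.1) ^ 2 + (c₂ - c₁) * ((χ (s, y₀.2)).2 - q.2) ^ 2)
        ((a₂ - a₁) * (e.symm (1, 0)).1) y₀.1 := by
      refine (((t1.const_mul (a₂ - a₁)).add ((t1.pow 2).const_mul (m₂ - m₁))).add
        ((t2.pow 2).const_mul (c₂ - c₁))).congr_deriv ?_
      simp [hχq]
    have hWO : (fun s => (a₂ - a₁) * ((χ (s, y₀.2)).1 - q.1) +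
        (m₂ - m₁) * ((χ (s, y₀.2)).1 - q.1) ^ 2 + (c₂ - c₁) * ((χ (s, y₀.2)).2 - q.2) ^ 2)
        =O[𝓝 y₀.1] fun s => s - y₀.1 := by
      simpa [hχq] using hW.isBigO_sub
    have hsmall := (hmain.comp_tendsto (k := fun s : ℝ => (s, y₀.2))
      (l' := 𝓝 y₀.1) lT.continuousAt).trans_isBigO hWO
    have hv₀ : v₂ y₀ - v₁ y₀ = 0 := by
      have e₁ := h₁.self_of_nhds
      have e₂ := h₂.self_of_nhds
      simp only [graphPt_jetFn, ← hy₀] at e₁ e₂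
      rw [e₁, e₂, sub_self]
    have h0 : HasDerivAt (fun s => v₂ (s, y₀.2) - v₁ (s, y₀.2) -
        η * ((a₂ - a₁) * ((χ (s, y₀.2)).1 - q.1) +
        (m₂ - m₁) * ((χ (s, y₀.2)).1 - q.1) ^ 2 + (c₂ - c₁) * ((χ (s, y₀.2)).2 - q.2) ^ 2))
        0 y₀.1 := by
      rw [hasDerivAt_iff_isLittleO]
      simpa [hχq, hv₀, Function.comp_def] using hsmall
    have h3 := h0.add (hW.const_mul η)
    have h4 : HasDerivAt (fun s => v₂ (s, y₀.2) - v₁ (s, y₀.2))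
        (0 + η * ((a₂ - a₁) * (e.symm (1, 0)).1)) y₀.1 :=
      h3.congr_of_eventuallyEq (Eventually.of_forall fun s => by simp)
    have h5 := h4.unique (k₂T.hasDerivAt.sub k₁T.hasDerivAt)
    linarith
  · have t1 : HasDerivAt (fun s => (χ (y₀.1, s)).1) (e.symm (0, 1)).1 y₀.2 :=
      HasFDerivAt.comp_hasDerivAt y₀.2 (f := fun s => χ (y₀.1, s)) hasFDerivAt_fst χX
    have t2 : HasDerivAt (fun s => (χ (y₀.1, s)).2) (e.symm (0, 1)).2 y₀.2 :=
      HasFDerivAt.comp_hasDerivAt y₀.2 (f := fun s => χ (y₀.1, s)) hasFDerivAt_snd χX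
    set κ := (m₂ - m₁) * (e.symm (0, 1)).1 ^ 2 + (c₂ - c₁) * (e.symm (0, 1)).2 ^ 2 with hκ
    have hW : (fun s => ((a₂ - a₁) * ((χ (y₀.1, s)).1 - q.1) +
        (m₂ - m₁) * ((χ (y₀.1, s)).1 - q.1) ^ 2 + (c₂ - c₁) * ((χ (y₀.1, s)).2 - q.2) ^ 2) -
        κ * (s - y₀.2) ^ 2) =o[𝓝 y₀.2] fun s => (s - y₀.2) ^ 2 := by
      have s1 := (sq_sub_isLittleO t1).const_mul_left (m₂ - m₁)
      have s2 := (sq_sub_isLittleO t2).const_mul_left (c₂ - c₁)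
      refine (s1.add s2).congr' ?_ EventuallyEq.rfl
      filter_upwards [hα χ hχ2.continuousAt hχq hχr] with s hs
      simp only [hs, hχq, Prod.mk.eta, hκ]
      ring
    have hWO : (fun s => (a₂ - a₁) * ((χ (y₀.1, s)).1 - q.1) +
        (m₂ - m₁) * ((χ (y₀.1, s)).1 - q.1) ^ 2 + (c₂ - c₁) * ((χ (y₀.1, s)).2 - q.2) ^ 2)
        =O[𝓝 y₀.2] fun s => (s - y₀.2) ^ 2 := by
      refine (hW.isBigO.add ((Asymptotics.isBigO_refl (fun s => (s - y₀.2) ^ 2) _).const_mul_left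
        κ)).congr_left fun s => ?_
      ring
    have hsmall := (hmain.comp_tendsto (k := fun s : ℝ => (y₀.1, s))
      (l' := 𝓝 y₀.2) lX.continuousAt).trans_isBigO hWO
    have hdiff : (fun s => (v₂ (y₀.1, s) - v₁ (y₀.1, s)) - (η * κ) * (s - y₀.2) ^ 2) =o[𝓝 y₀.2]
        fun s => (s - y₀.2) ^ 2 := by
      refine (hsmall.add (hW.const_mul_left η)).congr_left fun s => ?_
      simp only [Function.comp_apply]
      ring
    obtain ⟨r1, r2⟩ := derivs_eq_of_isLittleO (k₂X.sub k₁X) hdiff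
    have d1 : deriv (fun s => v₂ (y₀.1, s) - v₁ (y₀.1, s)) =ᶠ[𝓝 y₀.2]
        fun s => deriv (fun s => v₂ (y₀.1, s)) s - deriv (fun s => v₁ (y₀.1, s)) s := by
      filter_upwards [eventually_differentiableAt k₁X, eventually_differentiableAt k₂X] with s e₁ e₂
      exact deriv_fun_sub e₂ e₁
    have d2 : deriv (fun s => deriv (fun s => v₂ (y₀.1, s)) s - deriv (fun s => v₁ (y₀.1, s)) s)
        y₀.2 = _ := deriv_fun_sub ((contDiffAt_deriv k₂X).differentiableAt (by simp))
          ((contDiffAt_deriv k₁X).differentiableAt (by simp))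
    have r1' : deriv (fun s => v₂ (y₀.1, s) - v₁ (y₀.1, s)) y₀.2 = 0 := r1
    have r2' : deriv (deriv fun s => v₂ (y₀.1, s) - v₁ (y₀.1, s)) y₀.2 = 2 * (η * κ) := r2
    rw [d1.eq_of_nhds] at r1'
    rw [d1.deriv_eq, d2] at r2'
    constructor
    · linarith
    · linear_combination r2'

end jets

/-! ### Regularity of a point transformation and of the elements over its image -/

section regularity

variable {r : WithTop ℕ∞} {Ω : Set (ℝ × ℝ × ℝ)} {φ : ℝ × ℝ × ℝ → ℝ × ℝ × ℝ} {p : ℝ × ℝ × ℝ}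

theorem IsPointTransformation.contDiffAt (h : IsPointTransformation r Ω φ) (hr : 2 ≤ r)
    (hΩ : IsOpen Ω) (hp : p ∈ Ω) : ContDiffAt ℝ 2 φ p :=
  (h.contDiffOn.contDiffAt (hΩ.mem_nhds hp)).of_le hr

theorem IsPointTransformation.hasFDerivAt (h : IsPointTransformation r Ω φ) (hr : 2 ≤ r)
    (hΩ : IsOpen Ω) (hp : p ∈ Ω) : HasFDerivAt φ (fderiv ℝ φ p) p :=
  ((h.contDiffAt hr hΩ hp).differentiableAt (by simp)).hasFDerivAt

theorem IsPointTransformation.surjective (h : IsPointTransformation r Ω φ) (hp : p ∈ Ω) :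
    Function.Surjective (fderiv ℝ φ p) := by
  obtain ⟨e, he⟩ := h.isInvertible_fderiv p hp
  rw [← he]
  exact e.surjective

theorem IsPointTransformation.image_mem_nhds (h : IsPointTransformation r Ω φ) (hr : 2 ≤ r)
    (hΩ : IsOpen Ω) (hp : p ∈ Ω) (l : ℝ × ℝ × ℝ →L[ℝ] ℝ) (hl : Function.Surjective l) :
    (fun p => l (φ p)) '' Ω ∈ 𝓝 (l (φ p)) := by
  have hs := (h.contDiffAt hr hΩ hp).hasStrictFDerivAt (by simp)
  have hl' : HasStrictFDerivAt (fun p => l (φ p)) (l.comp (fderiv ℝ φ p)) p :=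
    l.hasStrictFDerivAt.comp p hs
  have hsurj : (l.comp (fderiv ℝ φ p)).range = ⊤ :=
    LinearMap.range_eq_top.2 (hl.comp (h.surjective hp))
  rw [← hl'.map_nhds_eq_of_surj hsurj]
  exact image_mem_map (hΩ.mem_nhds hp)

theorem Elements.InImageClass.differentiableAt_G {θ : Elements} (hθ : θ.InImageClass r Ω φ)
    (h : IsPointTransformation r Ω φ) (hr : 2 ≤ r) (hΩ : IsOpen Ω) (hp : p ∈ Ω) :
    DifferentiableAt ℝ θ.G (φ p).2.1 := by
  refine (hθ.contDiffOn_G.contDiffAt ?_).differentiableAt (by rintro rfl; simp at hr)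
  exact h.image_mem_nhds hr hΩ hp
    ((ContinuousLinearMap.fst ℝ ℝ ℝ).comp (ContinuousLinearMap.snd ℝ ℝ (ℝ × ℝ)))
    fun s => ⟨(0, s, 0), rfl⟩

theorem Elements.InImageClass.differentiableAt_A {θ : Elements} (hθ : θ.InImageClass r Ω φ)
    (h : IsPointTransformation r Ω φ) (hr : 2 ≤ r) (hΩ : IsOpen Ω) (hp : p ∈ Ω) :
    DifferentiableAt ℝ θ.A (φ p).2.2 := by
  refine (hθ.contDiffOn_A.contDiffAt ?_).differentiableAt (by rintro rfl; simp at hr)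
  exact h.image_mem_nhds hr hΩ hp
    ((ContinuousLinearMap.snd ℝ ℝ ℝ).comp (ContinuousLinearMap.snd ℝ ℝ (ℝ × ℝ)))
    fun s => ⟨(0, 0, s), rfl⟩

end regularity

/-! ### Coefficients of second derivatives -/

section coefficients

variable {Ω : Set (ℝ × ℝ × ℝ)} {φ : ℝ × ℝ × ℝ → ℝ × ℝ × ℝ} {D : ℝ × ℝ × ℝ →L[ℝ] ℝ × ℝ × ℝ}
  {t x z : ℝ} {θ θ' : Elements}

/-- If one quadratic jet solves the first equation, then a second one with the same tangent plane,
up to the slope in `t`, solves it if and only if the change of the image jet is compatible with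
the second equation. -/
theorem MapsEquation.equationAt_jetFn_iff (hmap : MapsEquation Ω φ θ θ') (hp : (t, x, z) ∈ Ω)
    (hφ : ContDiffAt ℝ 2 φ (t, x, z)) (hD : HasFDerivAt φ D (t, x, z))
    (hsurj : Function.Surjective D)
    (hG : DifferentiableAt ℝ θ'.G (φ (t, x, z)).2.1)
    (hA : DifferentiableAt ℝ θ'.A (φ (t, x, z)).2.2)
    {a₁ a₂ b m₁ m₂ c₁ c₂ : ℝ} (hJ₁ : baseJacobian D a₁ b ≠ 0) (hJ₂ : baseJacobian D a₂ b ≠ 0)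
    (hα : ∀ χ : ℝ × ℝ → ℝ × ℝ, ContinuousAt χ (base (φ (t, x, z))) →
      χ (base (φ (t, x, z))) = (t, x) →
      (∀ᶠ y in 𝓝 (base (φ (t, x, z))),
        base (φ (graphPt (jetFn (t, x) z a₂ b m₂ c₂) (χ y))) = y) →
      ∀ᶠ s in 𝓝 (φ (t, x, z)).2.1, (a₂ - a₁) * ((χ ((φ (t, x, z)).1, s)).1 - t) = 0)
    (hu₁ : θ.EquationAt (jetFn (t, x) z a₁ b m₁ c₁) (t, x)) :
    θ.EquationAt (jetFn (t, x) z a₂ b m₂ c₂) (t, x) ↔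
      (a₂ - a₁) * ((D (0, 1, b)).2.1 / baseJacobian D a₂ b) =
        θ'.G (φ (t, x, z)).2.1 * θ'.A (φ (t, x, z)).2.2 *
          (2 * ((m₂ - m₁) * (-(D (0, 1, b)).1 / baseJacobian D a₂ b) ^ 2 +
            (c₂ - c₁) * ((D (1, 0, a₂)).1 / baseJacobian D a₂ b) ^ 2)) := by
  obtain ⟨e₁, he₁, -, -, -⟩ := exists_equiv_of_baseJacobian_ne_zero hJ₁
  obtain ⟨e₂, he₂, i₁, i₂, i₃⟩ := exists_equiv_of_baseJacobian_ne_zero hJ₂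
  have hu : ∀ a m c, ContDiffAt ℝ 2 (jetFn (t, x) z a b m c) (t, x) := fun a m c =>
    (contDiff_jetFn ..).contDiffAt
  obtain ⟨v₁, hv₁, h₁⟩ := exists_image (by simpa using hφ) (by simpa using hD) (hu a₁ m₁ c₁)
    (hasFDerivAt_jetFn ..) he₁
  obtain ⟨v₂, hv₂, h₂⟩ := exists_image (by simpa using hφ) (by simpa using hD) (hu a₂ m₂ c₂)
    (hasFDerivAt_jetFn ..) he₂
  have hη := verticalFactor_ne_zero (by simpa using hD) hsurj (hasFDerivAt_jetFn ..)
    (hv₁.differentiableAt (by simp)) h₁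
  have hm₁ := (hmap _ v₁ (t, x) (by simpa using hp) (hu a₁ m₁ c₁) hv₁ h₁).1 hu₁
  have hm₂ := hmap _ v₂ (t, x) (by simpa using hp) (hu a₂ m₂ c₂) hv₂ h₂
  have w₁ := h₁.self_of_nhds
  have w₂ := h₂.self_of_nhds
  simp only [graphPt_jetFn] at hv₁ hv₂ hη hm₁ hm₂ w₁ w₂
  obtain ⟨k₁, k₂, k₃⟩ := jetFn_image_derivs (y₀ := base (φ (t, x, z))) (q := (t, x)) hφ hD rfl he₂
    hv₁ hv₂ h₁ h₂ hα
  rw [hm₂, Elements.equationAt_iff hv₂ hG (by rw [w₂]; exact hA)]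
  rw [Elements.equationAt_iff hv₁ hG (by rw [w₁]; exact hA)] at hm₁
  rw [k₁, k₂, k₃, w₂, hm₁, w₁, i₁, i₂, i₃]
  set η := verticalFactor D v₁ (base (φ (t, x, z)))
  constructor
  · intro h
    refine mul_left_cancel₀ hη ?_
    simp only [base] at h ⊢
    linear_combination h
  · intro h
    simp only [base] at h ⊢
    linear_combination η * h

/-- The constant elements `A = G = 1`, `W = 0`. -/
def heat : Elements := ⟨fun _ => 1, fun _ => 1, fun _ => 0⟩

theorem heat_equationAt_jetFn {q : ℝ × ℝ} {a b m c : ℝ} :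
    heat.EquationAt (jetFn q z a b m c) q ↔ a = 2 * c := by
  rw [Elements.equationAt_jetFn q z a b m c (differentiableAt_const 1) (differentiableAt_const 1)]
  simp [heat]

/-- The parabolic equation contains no second derivatives with respect to `t`, so the surfaces
`t̃ = const` must be tangent to the surfaces `t = const`. -/
theorem MapsEquation.fst_apply_eq_zero_of_baseJacobian_ne_zero (hmap : MapsEquation Ω φ heat θ')
    (hp : (t, x, z) ∈ Ω) (hφ : ContDiffAt ℝ 2 φ (t, x, z)) (hD : HasFDerivAt φ D (t, x, z))
    (hsurj : Function.Surjective D)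
    (hG : DifferentiableAt ℝ θ'.G (φ (t, x, z)).2.1)
    (hA : DifferentiableAt ℝ θ'.A (φ (t, x, z)).2.2)
    {a b : ℝ} (hJ : baseJacobian D a b ≠ 0) : (D (0, 1, b)).1 = 0 := by
  have hu : heat.EquationAt (jetFn (t, x) z a b 0 (a / 2)) (t, x) :=
    heat_equationAt_jetFn.2 (by ring)
  have key : ∀ m c, _ := fun m c => hmap.equationAt_jetFn_iff (m₂ := m) (c₂ := c) hp hφ hD hsurj
    hG hA hJ hJ (fun χ _ _ _ => Eventually.of_forall fun s => by simp) hu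
  simp only [heat_equationAt_jetFn, sub_self, zero_mul, sub_zero] at key
  -- changing `u_xx` destroys the equation, changing `u_tt` does not
  have k₁ := key 0 (a / 2 + 1)
  have k₂ := (key 1 (a / 2)).1 (by ring)
  have hne : θ'.G (φ (t, x, z)).2.1 * θ'.A (φ (t, x, z)).2.2 ≠ 0 := by
    intro h0
    rw [h0] at k₁
    have := k₁.2 (by ring)
    linarith
  have h2 : (-(D (0, 1, b)).1 / baseJacobian D a b) ^ 2 = 0 := by
    have := (mul_eq_zero.1 k₂.symm).resolve_left hne
    linarith
  have h3 := (div_eq_zero_iff.1 (pow_eq_zero_iff (two_ne_zero) |>.1 h2)).resolve_right hJ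
  linarith

theorem apply_eq (D : ℝ × ℝ × ℝ →L[ℝ] ℝ × ℝ × ℝ) (p : ℝ × ℝ × ℝ) :
    D p = p.1 • D (1, 0, 0) + p.2.1 • D (0, 1, 0) + p.2.2 • D (0, 0, 1) := by
  rw [← map_smul, ← map_smul, ← map_smul, ← map_add, ← map_add]
  congr 1
  ext <;> simp

/-- The 2 × 2 minors of `dT`, `dX` are the coefficients of the Jacobian as a polynomial in the slopes
`a`, `b`. They do not all vanish, so `T_x + b T_u` vanishes for enough slopes `b`. -/
theorem fst_apply_eq_zero_of_forall (hsurj : Function.Surjective D)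
    (h : ∀ a b, baseJacobian D a b ≠ 0 → (D (0, 1, b)).1 = 0) :
    (D (0, 1, 0)).1 = 0 ∧ (D (0, 0, 1)).1 = 0 := by
  obtain ⟨p₁, hp₁⟩ := hsurj (1, 0, 0)
  obtain ⟨p₂, hp₂⟩ := hsurj (0, 1, 0)
  set T₁ := (D (1, 0, 0)).1 with hT₁
  set T₂ := (D (0, 1, 0)).1 with hT₂
  set T₃ := (D (0, 0, 1)).1 with hT₃
  set X₁ := (D (1, 0, 0)).2.1 with hX₁
  set X₂ := (D (0, 1, 0)).2.1 with hX₂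
  set X₃ := (D (0, 0, 1)).2.1 with hX₃
  have hprod : ∀ a b, (T₂ + b * T₃) *
      ((T₁ + a * T₃) * (X₂ + b * X₃) - (T₂ + b * T₃) * (X₁ + a * X₃)) = 0 := by
    intro a b
    have e₁ : D (0, 1, b) = D (0, 1, 0) + b • D (0, 0, 1) := by rw [apply_eq]; simp
    have e₂ : D (1, 0, a) = D (1, 0, 0) + a • D (0, 0, 1) := by rw [apply_eq]; simp
    by_cases hJ : baseJacobian D a b = 0
    · rw [baseJacobian, e₁, e₂] at hJ
      simp only [Prod.fst_add, Prod.snd_add, Prod.smul_fst, Prod.smul_snd, smul_eq_mul] at hJ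
      rw [hJ, mul_zero]
    · have := h a b hJ
      rw [e₁] at this
      simp only [Prod.fst_add, Prod.smul_fst, smul_eq_mul] at this
      rw [this, zero_mul]
  rw [apply_eq] at hp₁ hp₂
  have a₁ := congrArg Prod.fst hp₁
  have a₂ := congrArg (fun p => p.2.1) hp₁
  have b₁ := congrArg Prod.fst hp₂
  have b₂ := congrArg (fun p => p.2.1) hp₂
  simp only [Prod.fst_add, Prod.snd_add, Prod.smul_fst, Prod.smul_snd, smul_eq_mul, ← hT₁, ← hT₂,
    ← hT₃, ← hX₁, ← hX₂, ← hX₃] at a₁ a₂ b₁ b₂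
  -- the 2 × 2 minors are the coefficients of the Jacobian in `a` and `b`
  obtain ⟨d₀, hd₀⟩ : ∃ d, d = T₁ * X₂ - T₂ * X₁ := ⟨_, rfl⟩
  obtain ⟨d₁, hd₁⟩ : ∃ d, d = T₃ * X₂ - T₂ * X₃ := ⟨_, rfl⟩
  obtain ⟨d₂, hd₂⟩ : ∃ d, d = T₁ * X₃ - T₃ * X₁ := ⟨_, rfl⟩
  have hmin : d₀ ≠ 0 ∨ d₁ ≠ 0 ∨ d₂ ≠ 0 := by
    by_contra! hcon
    obtain ⟨z₀, z₁, z₂⟩ := hcon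
    rw [hd₀] at z₀
    rw [hd₁] at z₁
    rw [hd₂] at z₂
    have : (1 : ℝ) = 0 := by
      linear_combination -b₂ * (p₁.1 * T₁ + p₁.2.1 * T₂ + p₁.2.2 * T₃) - a₁ +
        b₁ * (p₁.1 * X₁ + p₁.2.1 * X₂ + p₁.2.2 * X₃) +
        (p₁.1 * p₂.2.1 - p₁.2.1 * p₂.1) * z₀ + (p₁.2.2 * p₂.2.1 - p₁.2.1 * p₂.2.2) * z₁ +
        (p₁.1 * p₂.2.2 - p₁.2.2 * p₂.1) * z₂
    exact one_ne_zero this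
  have hprod' : ∀ a b, (T₂ + b * T₃) * (d₀ + a * d₁ + b * d₂) = 0 := fun a b => by
    have := hprod a b
    rw [hd₀, hd₁, hd₂]
    linear_combination this
  have c₀ : T₂ * d₀ = 0 := by linear_combination hprod' 0 0
  have c₁ : T₂ * d₁ = 0 := by linear_combination hprod' 1 0 - hprod' 0 0
  have c₃ : T₃ * d₁ = 0 := by
    linear_combination hprod' 1 1 - hprod' 0 1 - hprod' 1 0 + hprod' 0 0
  have c₂ : T₂ * d₂ + T₃ * d₀ = 0 := by
    linear_combination (hprod' 0 1 - hprod' 0 (-1)) / 2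
  have c₄ : T₃ * d₂ = 0 := by
    linear_combination (hprod' 0 1 + hprod' 0 (-1)) / 2 - hprod' 0 0
  by_cases h₁ : d₁ = 0
  · by_cases h₂ : d₂ = 0
    · have h₀ : d₀ ≠ 0 := by tauto
      rw [h₂, mul_zero, zero_add] at c₂
      exact ⟨(mul_eq_zero.1 c₀).resolve_right h₀, (mul_eq_zero.1 c₂).resolve_right h₀⟩
    · have h₃ := (mul_eq_zero.1 c₄).resolve_right h₂
      rw [h₃, zero_mul, add_zero] at c₂
      exact ⟨(mul_eq_zero.1 c₂).resolve_right h₂, h₃⟩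
  · exact ⟨(mul_eq_zero.1 c₁).resolve_right h₁, (mul_eq_zero.1 c₃).resolve_right h₁⟩

/-- Comparison of the coefficients of `u_xx`, once `t̃` depends on `t` only. -/
theorem MapsEquation.leading_coefficient (hmap : MapsEquation Ω φ θ θ') (hΩ : IsOpen Ω)
    (hp : (t, x, z) ∈ Ω) (hφ : ContDiffAt ℝ 2 φ (t, x, z)) (hD : HasFDerivAt φ D (t, x, z))
    (hsurj : Function.Surjective D)
    (hG : DifferentiableAt ℝ θ'.G (φ (t, x, z)).2.1)
    (hA : DifferentiableAt ℝ θ'.A (φ (t, x, z)).2.2)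
    (hG₀ : DifferentiableAt ℝ θ.G x) (hA₀ : DifferentiableAt ℝ θ.A z)
    (hT : ∀ p ∈ Ω, ∀ p' ∈ Ω, p.1 = p'.1 → (φ p).1 = (φ p').1)
    (hx : (D (0, 1, 0)).1 = 0) (hz : (D (0, 0, 1)).1 = 0) (ht : (D (1, 0, 0)).1 ≠ 0)
    {b : ℝ} (hb : (D (0, 1, b)).2.1 ≠ 0) :
    θ'.G (φ (t, x, z)).2.1 * θ'.A (φ (t, x, z)).2.2 * (D (1, 0, 0)).1 =
      θ.G x * θ.A z * (D (0, 1, b)).2.1 ^ 2 := by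
  have e₁ : (D (0, 1, b)).1 = 0 := by rw [apply_eq]; simp [hx, hz]
  have e₂ : ∀ a, (D (1, 0, a)).1 = (D (1, 0, 0)).1 := fun a => by rw [apply_eq]; simp [hz]
  have hJ : ∀ a, baseJacobian D a b = (D (1, 0, 0)).1 * (D (0, 1, b)).2.1 := fun a => by
    rw [baseJacobian, e₁, e₂]
    ring
  have hJ' : ∀ a, baseJacobian D a b ≠ 0 := fun a => by
    rw [hJ]
    exact mul_ne_zero ht hb
  set R := deriv θ.G x * θ.A z * b + θ.G x * deriv θ.A z * b ^ 2 + θ.W t with hR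
  have heq : ∀ a c, θ.EquationAt (jetFn (t, x) z a b 0 c) (t, x) ↔
      a = R + θ.G x * θ.A z * (2 * c) := fun a c => by
    rw [Elements.equationAt_jetFn (t, x) z a b 0 c hG₀ hA₀, hR]
    constructor <;> intro h <;> rw [h] <;> simp only <;> ring
  have hside : ∀ a c, ∀ χ : ℝ × ℝ → ℝ × ℝ, ContinuousAt χ (base (φ (t, x, z))) →
      χ (base (φ (t, x, z))) = (t, x) →
      (∀ᶠ y in 𝓝 (base (φ (t, x, z))),
        base (φ (graphPt (jetFn (t, x) z a b 0 c) (χ y))) = y) →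
      ∀ᶠ s in 𝓝 (φ (t, x, z)).2.1, (χ ((φ (t, x, z)).1, s)).1 = t := by
    intro a c χ hχ hχ₀ hχr
    have hl : Tendsto (fun s : ℝ => ((φ (t, x, z)).1, s)) (𝓝 (φ (t, x, z)).2.1)
        (𝓝 (base (φ (t, x, z)))) := by
      have : Continuous fun s : ℝ => ((φ (t, x, z)).1, s) := by fun_prop
      exact this.continuousAt
    have hχt : Tendsto (fun s => χ ((φ (t, x, z)).1, s)) (𝓝 (φ (t, x, z)).2.1) (𝓝 (t, x)) := by
      have : Tendsto χ (𝓝 (base (φ (t, x, z)))) (𝓝 (t, x)) := hχ₀ ▸ hχ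
      exact this.comp hl
    -- `t̃`, as a function of `t` alone, does not take the value `t̃(t)` at other points near `t`
    have hder : HasDerivAt (fun s => (φ (s, x, z)).1) (D (1, 0, 0)).1 t := by
      have hline : HasDerivAt (fun s : ℝ => (s, x, z)) ((1, 0, 0) : ℝ × ℝ × ℝ) t :=
        (hasDerivAt_id _).prodMk ((hasDerivAt_const _ _).prodMk (hasDerivAt_const _ _))
      have := HasFDerivAt.comp_hasDerivAt t (l := φ) (f := fun s : ℝ => (s, x, z)) hD hline
      exact HasFDerivAt.comp_hasDerivAt t (f := fun s : ℝ => φ (s, x, z)) hasFDerivAt_fst this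
    have hne : ∀ᶠ s in 𝓝 t, s ≠ t → (φ (s, x, z)).1 ≠ (φ (t, x, z)).1 :=
      eventually_nhdsWithin_iff.1 (hder.eventually_ne ht)
    have hΩ₁ : ∀ᶠ s in 𝓝 t, (s, x, z) ∈ Ω := by
      have : Continuous fun s : ℝ => (s, x, z) := by fun_prop
      exact this.continuousAt.eventually (hΩ.mem_nhds hp)
    have hΩ₂ : ∀ᶠ q' in 𝓝 (t, x), graphPt (jetFn (t, x) z a b 0 c) q' ∈ Ω := by
      have : ContinuousAt (graphPt (jetFn (t, x) z a b 0 c)) (t, x) :=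
        (contDiffAt_graphPt (contDiff_jetFn ..).contDiffAt).continuousAt
      refine this.eventually (hΩ.mem_nhds ?_)
      simpa using hp
    have hfst : Tendsto (fun s => (χ ((φ (t, x, z)).1, s)).1) (𝓝 (φ (t, x, z)).2.1) (𝓝 t) :=
      (continuous_fst.tendsto (t, x)).comp hχt
    filter_upwards [hfst.eventually hne, hfst.eventually hΩ₁, hχt.eventually hΩ₂,
      hl.eventually hχr] with s s₁ s₂ s₃ s₄
    by_contra hcon
    refine s₁ hcon ?_
    rw [hT _ s₂ _ s₃ rfl]
    have s₅ := congrArg Prod.fst s₄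
    exact s₅
  have key := (hmap.equationAt_jetFn_iff (a₁ := R) (a₂ := R + θ.G x * θ.A z * (2 * 1)) (b := b)
    (m₁ := 0) (m₂ := 0) (c₁ := 0) (c₂ := 1) hp hφ hD hsurj hG hA (hJ' _) (hJ' _)
    (fun χ h₁ h₂ h₃ => (hside _ _ χ h₁ h₂ h₃).mono fun s hs => by rw [hs]; ring)
    ((heq _ _).2 (by ring))).1 ((heq _ _).2 (by ring))
  rw [hJ, e₁, e₂ (R + θ.G x * θ.A z * (2 * 1))] at key
  generalize (D (1, 0, 0)).1 = τ at *
  generalize (D (0, 1, b)).2.1 = ξ at *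
  field_simp at key
  refine mul_left_cancel₀ ht ?_
  linear_combination -key / 2

end coefficients

/-! ### Separation of the variables -/

/-- The ranges of the variables are non-empty open intervals. -/
structure IsOpenBox (I J K : Set ℝ) : Prop where
  isOpen_I : IsOpen I
  isOpen_J : IsOpen J
  isOpen_K : IsOpen K
  ordConnected_I : I.OrdConnected
  ordConnected_J : J.OrdConnected
  ordConnected_K : K.OrdConnected
  nonempty_I : I.Nonempty
  nonempty_J : J.Nonempty
  nonempty_K : K.Nonempty

section box

variable {I J K : Set ℝ}

theorem IsOpenBox.isOpen (hB : IsOpenBox I J K) : IsOpen (box I J K) :=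
  hB.isOpen_I.prod (hB.isOpen_J.prod hB.isOpen_K)

theorem IsOpenBox.convex (hB : IsOpenBox I J K) : Convex ℝ (box I J K) :=
  hB.ordConnected_I.convex.prod (hB.ordConnected_J.convex.prod hB.ordConnected_K.convex)

theorem exists_mem_ne {S : Set ℝ} (hS : IsOpen S) {x : ℝ} (hx : x ∈ S) : ∃ y ∈ S, y ≠ x := by
  obtain ⟨y, hy, hyx⟩ := ((eventually_nhdsWithin_of_eventually_nhds (s := {x}ᶜ)
    (hS.mem_nhds hx)).and self_mem_nhdsWithin).exists
  exact ⟨y, hy, hyx⟩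

end box

/-- A component of `φ` is constant along segments on which its derivative in the direction of the
segment vanishes. -/
theorem eq_of_apply_fderiv_eq_zero {Ω : Set (ℝ × ℝ × ℝ)} (hc : Convex ℝ Ω)
    {φ : ℝ × ℝ × ℝ → ℝ × ℝ × ℝ} (hφ : ∀ p ∈ Ω, HasFDerivAt φ (fderiv ℝ φ p) p)
    (l : ℝ × ℝ × ℝ →L[ℝ] ℝ) {p p' : ℝ × ℝ × ℝ} (hp : p ∈ Ω) (hp' : p' ∈ Ω)
    (h : ∀ p'' ∈ Ω, l (fderiv ℝ φ p'' (p' - p)) = 0) : l (φ p') = l (φ p) := by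
  have hmem : ∀ s ∈ Icc (0 : ℝ) 1, p + s • (p' - p) ∈ Ω := fun s hs =>
    hc.add_smul_sub_mem hp hp' hs
  have hd : ∀ s ∈ Icc (0 : ℝ) 1, HasDerivAt (fun s : ℝ => l (φ (p + s • (p' - p)))) 0 s := by
    intro s hs
    have h1 : HasDerivAt (fun s : ℝ => p + s • (p' - p)) (p' - p) s := by
      simpa using ((hasDerivAt_id s).smul_const (p' - p)).const_add p
    have h2 := (hφ _ (hmem s hs)).comp_hasDerivAt s h1
    have h3 := l.hasFDerivAt.comp_hasDerivAt s h2
    rw [h _ (hmem s hs)] at h3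
    exact h3
  have := constant_of_has_deriv_right_zero
    (fun s hs => (hd s hs).continuousAt.continuousWithinAt)
    (fun s hs => (hd s ⟨hs.1, hs.2.le⟩).hasDerivWithinAt) 1 (by simp)
  simpa using this

/-- If `l ∘ φ` agrees along the parallel lines in direction `e` through `p` and `p'`, so do its
derivatives in that direction. -/
theorem apply_fderiv_eq {Ω : Set (ℝ × ℝ × ℝ)} (hΩ : IsOpen Ω)
    {φ : ℝ × ℝ × ℝ → ℝ × ℝ × ℝ} (hφ : ∀ p ∈ Ω, HasFDerivAt φ (fderiv ℝ φ p) p)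
    (l : ℝ × ℝ × ℝ →L[ℝ] ℝ) {e p p' : ℝ × ℝ × ℝ} (hp : p ∈ Ω) (hp' : p' ∈ Ω)
    (h : ∀ s : ℝ, p + s • e ∈ Ω → p' + s • e ∈ Ω → l (φ (p + s • e)) = l (φ (p' + s • e))) :
    l (fderiv ℝ φ p e) = l (fderiv ℝ φ p' e) := by
  have hd : ∀ p ∈ Ω, HasDerivAt (fun s : ℝ => l (φ (p + s • e))) (l (fderiv ℝ φ p e)) 0 := by
    intro p hp
    have h1 : HasDerivAt (fun s : ℝ => p + s • e) e 0 := by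
      simpa using ((hasDerivAt_id (0 : ℝ)).smul_const e).const_add p
    have h2 : HasFDerivAt φ (fderiv ℝ φ p) (p + (0 : ℝ) • e) := by
      simpa using hφ p hp
    exact l.hasFDerivAt.comp_hasDerivAt (0 : ℝ) (h2.comp_hasDerivAt (0 : ℝ) h1)
  have hm : ∀ p ∈ Ω, ∀ᶠ s : ℝ in 𝓝 0, p + s • e ∈ Ω := fun p hp => by
    have : Continuous fun s : ℝ => p + s • e := by fun_prop
    refine this.continuousAt.eventually (hΩ.mem_nhds ?_)
    simpa using hp
  refine (hd p hp).unique ((hd p' hp').congr_of_eventuallyEq ?_)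
  filter_upwards [hm p hp, hm p' hp'] with s h₁ h₂
  exact h s h₁ h₂

section class_elements

variable {r : WithTop ℕ∞} {I J K : Set ℝ}

theorem heat_inClass (hB : IsOpenBox I J K) : heat.InClass r I J K where
  contDiffOn_A := contDiffOn_const
  contDiffOn_G := contDiffOn_const
  contDiffOn_W := contDiffOn_const
  exists_A_ne_zero := hB.nonempty_K.imp fun _ h => ⟨h, one_ne_zero⟩
  exists_G_ne_zero := hB.nonempty_J.imp fun _ h => ⟨h, one_ne_zero⟩

/-- Elements with `A = 1 + α (u - u₀)²`, `G = 1 + γ (x - x₀)²` and `W = 0`. -/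
def quadratic (α u₀ γ x₀ : ℝ) : Elements :=
  ⟨fun u => 1 + α * (u - u₀) ^ 2, fun x => 1 + γ * (x - x₀) ^ 2, fun _ => 0⟩

theorem quadratic_inClass {α u₀ γ x₀ : ℝ} (hu₀ : u₀ ∈ K) (hx₀ : x₀ ∈ J) :
    (quadratic α u₀ γ x₀).InClass r I J K where
  contDiffOn_A := by unfold quadratic; fun_prop
  contDiffOn_G := by unfold quadratic; fun_prop
  contDiffOn_W := contDiffOn_const
  exists_A_ne_zero := ⟨u₀, hu₀, by simp [quadratic]⟩
  exists_G_ne_zero := ⟨x₀, hx₀, by simp [quadratic]⟩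

end class_elements

namespace IsEquivalenceTransformation

variable {r : WithTop ℕ∞} {I J K : Set ℝ} {φ : ℝ × ℝ × ℝ → ℝ × ℝ × ℝ} {p p' : ℝ × ℝ × ℝ}

theorem hasFDerivAt (h : IsEquivalenceTransformation r I J K φ) (hr : 2 ≤ r)
    (hB : IsOpenBox I J K) (hp : p ∈ box I J K) : HasFDerivAt φ (fderiv ℝ φ p) p :=
  h.1.hasFDerivAt hr hB.isOpen hp

theorem fst_apply_eq_zero (h : IsEquivalenceTransformation r I J K φ) (hr : 2 ≤ r)
    (hB : IsOpenBox I J K) (hp : p ∈ box I J K) :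
    (fderiv ℝ φ p (0, 1, 0)).1 = 0 ∧ (fderiv ℝ φ p (0, 0, 1)).1 = 0 := by
  obtain ⟨θ', hθ', hmap⟩ := h.2 heat (heat_inClass hB)
  exact fst_apply_eq_zero_of_forall (h.1.surjective hp) fun a b hJ =>
    hmap.fst_apply_eq_zero_of_baseJacobian_ne_zero hp (h.1.contDiffAt hr hB.isOpen hp)
      (h.hasFDerivAt hr hB hp) (h.1.surjective hp) (hθ'.differentiableAt_G h.1 hr hB.isOpen hp)
      (hθ'.differentiableAt_A h.1 hr hB.isOpen hp) hJ

theorem fst_eq (h : IsEquivalenceTransformation r I J K φ) (hr : 2 ≤ r)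
    (hB : IsOpenBox I J K) (hp : p ∈ box I J K) (hp' : p' ∈ box I J K) (ht : p.1 = p'.1) :
    (φ p).1 = (φ p').1 := by
  refine eq_of_apply_fderiv_eq_zero hB.convex (fun _ hq => h.hasFDerivAt hr hB hq)
    (ContinuousLinearMap.fst ℝ ℝ (ℝ × ℝ)) hp' hp fun p'' hp'' => ?_
  rw [apply_eq]
  simp [ht, h.fst_apply_eq_zero hr hB hp'']

theorem fst_apply_ne_zero (h : IsEquivalenceTransformation r I J K φ) (hr : 2 ≤ r)
    (hB : IsOpenBox I J K) (hp : p ∈ box I J K) : (fderiv ℝ φ p (1, 0, 0)).1 ≠ 0 := by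
  intro h0
  obtain ⟨p₁, hp₁⟩ := h.1.surjective hp (1, 0, 0)
  have := congrArg Prod.fst hp₁
  rw [apply_eq] at this
  simp [h.fst_apply_eq_zero hr hB hp, h0] at this

theorem leading_coefficient (h : IsEquivalenceTransformation r I J K φ) (hr : 2 ≤ r)
    (hB : IsOpenBox I J K) {θ θ' : Elements} (hθ : θ.InClass r I J K)
    (hθ' : θ'.InImageClass r (box I J K) φ) (hmap : MapsEquation (box I J K) φ θ θ')
    (hp : p ∈ box I J K) {b : ℝ} (hb : (fderiv ℝ φ p (0, 1, b)).2.1 ≠ 0) :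
    θ'.G (φ p).2.1 * θ'.A (φ p).2.2 * (fderiv ℝ φ p (1, 0, 0)).1 =
      θ.G p.2.1 * θ.A p.2.2 * (fderiv ℝ φ p (0, 1, b)).2.1 ^ 2 := by
  have hr' : r ≠ 0 := by rintro rfl; simp at hr
  exact hmap.leading_coefficient hB.isOpen (t := p.1) (x := p.2.1) (z := p.2.2) hp
    (h.1.contDiffAt hr hB.isOpen hp) (h.hasFDerivAt hr hB hp) (h.1.surjective hp)
    (hθ'.differentiableAt_G h.1 hr hB.isOpen hp) (hθ'.differentiableAt_A h.1 hr hB.isOpen hp)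
    ((hθ.contDiffOn_G.contDiffAt (hB.isOpen_J.mem_nhds hp.2.1)).differentiableAt hr')
    ((hθ.contDiffOn_A.contDiffAt (hB.isOpen_K.mem_nhds hp.2.2)).differentiableAt hr')
    (fun p hp p' hp' => h.fst_eq hr hB hp hp') (h.fst_apply_eq_zero hr hB hp).1
    (h.fst_apply_eq_zero hr hB hp).2 (h.fst_apply_ne_zero hr hB hp) hb

/-- The coefficient of `u_xx` does not depend on `u_x`, so neither does `D_x x̃`. -/
theorem snd_apply_eq_zero (h : IsEquivalenceTransformation r I J K φ) (hr : 2 ≤ r)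
    (hB : IsOpenBox I J K) (hp : p ∈ box I J K) : (fderiv ℝ φ p (0, 0, 1)).2.1 = 0 := by
  by_contra hX
  obtain ⟨θ', hθ', hmap⟩ := h.2 heat (heat_inClass hB)
  have key : ∀ b, _ := fun b =>
    h.leading_coefficient hr hB (heat_inClass hB) hθ' hmap hp (b := b)
  have e : ∀ b, (fderiv ℝ φ p (0, 1, b)).2.1 =
      (fderiv ℝ φ p (0, 1, 0)).2.1 + b * (fderiv ℝ φ p (0, 0, 1)).2.1 := fun b => by
    rw [apply_eq]
    simp
  have e' : ∀ c, (fderiv ℝ φ p (0, 1, (c - (fderiv ℝ φ p (0, 1, 0)).2.1) /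
      (fderiv ℝ φ p (0, 0, 1)).2.1)).2.1 = c := fun c => by
    rw [e]
    field_simp
    ring
  have k₁ := key _ ((e' 1).symm ▸ one_ne_zero)
  have k₂ := key _ ((e' 2).symm ▸ two_ne_zero)
  rw [e'] at k₁ k₂
  rw [k₁] at k₂
  norm_num [heat] at k₂

theorem snd_apply_ne_zero (h : IsEquivalenceTransformation r I J K φ) (hr : 2 ≤ r)
    (hB : IsOpenBox I J K) (hp : p ∈ box I J K) : (fderiv ℝ φ p (0, 1, 0)).2.1 ≠ 0 := by
  intro h0
  obtain ⟨p₁, hp₁⟩ := h.1.surjective hp (0, 1, 0)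
  have e₁ := congrArg Prod.fst hp₁
  have e₂ := congrArg (fun p => p.2.1) hp₁
  rw [apply_eq] at e₁ e₂
  simp [h.fst_apply_eq_zero hr hB hp, h.fst_apply_ne_zero hr hB hp] at e₁
  simp [e₁, h0, h.snd_apply_eq_zero hr hB hp] at e₂

theorem trd_apply_ne_zero (h : IsEquivalenceTransformation r I J K φ) (hr : 2 ≤ r)
    (hB : IsOpenBox I J K) (hp : p ∈ box I J K) : (fderiv ℝ φ p (0, 0, 1)).2.2 ≠ 0 := by
  intro h0
  have h1 : fderiv ℝ φ p (0, 0, 1) = fderiv ℝ φ p 0 := by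
    rw [map_zero]
    ext
    · exact (h.fst_apply_eq_zero hr hB hp).2
    · exact h.snd_apply_eq_zero hr hB hp
    · exact h0
  obtain ⟨e, he⟩ := h.1.isInvertible_fderiv p hp
  rw [← he] at h1
  have := e.injective h1
  simp at this

/-- The relation between the elements of an equation and of its image on which the separation of the
variables rests. -/
theorem exists_image_elements (h : IsEquivalenceTransformation r I J K φ) (hr : 2 ≤ r)
    (hB : IsOpenBox I J K) {θ : Elements} (hθ : θ.InClass r I J K) :
    ∃ θ' : Elements, θ'.InImageClass r (box I J K) φ ∧ MapsEquation (box I J K) φ θ θ' ∧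
      ∀ p ∈ box I J K, θ'.G (φ p).2.1 * θ'.A (φ p).2.2 * (fderiv ℝ φ p (1, 0, 0)).1 =
        θ.G p.2.1 * θ.A p.2.2 * (fderiv ℝ φ p (0, 1, 0)).2.1 ^ 2 := by
  obtain ⟨θ', hθ', hmap⟩ := h.2 θ hθ
  exact ⟨θ', hθ', hmap, fun p hp =>
    h.leading_coefficient hr hB hθ hθ' hmap hp (h.snd_apply_ne_zero hr hB hp)⟩

theorem snd_eq (h : IsEquivalenceTransformation r I J K φ) (hr : 2 ≤ r)
    (hB : IsOpenBox I J K) (hp : p ∈ box I J K) (hp' : p' ∈ box I J K) (ht : p.1 = p'.1)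
    (hx : p.2.1 = p'.2.1) : (φ p).2.1 = (φ p').2.1 := by
  refine eq_of_apply_fderiv_eq_zero hB.convex (fun _ hq => h.hasFDerivAt hr hB hq)
    ((ContinuousLinearMap.fst ℝ ℝ ℝ).comp (ContinuousLinearMap.snd ℝ ℝ (ℝ × ℝ))) hp' hp
    fun p'' hp'' => ?_
  rw [apply_eq]
  simp [ht, hx, h.snd_apply_eq_zero hr hB hp'']

theorem fst_apply_eq (h : IsEquivalenceTransformation r I J K φ) (hr : 2 ≤ r)
    (hB : IsOpenBox I J K) (hp : p ∈ box I J K) (hp' : p' ∈ box I J K) (ht : p.1 = p'.1) :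
    (fderiv ℝ φ p (1, 0, 0)).1 = (fderiv ℝ φ p' (1, 0, 0)).1 :=
  apply_fderiv_eq hB.isOpen (fun _ hq => h.hasFDerivAt hr hB hq)
    (ContinuousLinearMap.fst ℝ ℝ (ℝ × ℝ)) hp hp' fun s h₁ h₂ =>
      h.fst_eq hr hB h₁ h₂ (by simp [ht])

theorem snd_apply_eq (h : IsEquivalenceTransformation r I J K φ) (hr : 2 ≤ r)
    (hB : IsOpenBox I J K) (hp : p ∈ box I J K) (hp' : p' ∈ box I J K) (ht : p.1 = p'.1)
    (hx : p.2.1 = p'.2.1) :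
    (fderiv ℝ φ p (0, 1, 0)).2.1 = (fderiv ℝ φ p' (0, 1, 0)).2.1 :=
  apply_fderiv_eq hB.isOpen (fun _ hq => h.hasFDerivAt hr hB hq)
    ((ContinuousLinearMap.fst ℝ ℝ ℝ).comp (ContinuousLinearMap.snd ℝ ℝ (ℝ × ℝ))) hp hp'
      fun s h₁ h₂ => h.snd_eq hr hB h₁ h₂ (by simp [ht]) (by simp [hx])

/-- With `A = 1 + (u - u₀)²` and `G = 1`, the function `Ã ∘ ũ` is `1 + (u - u₀)²` times its
restriction to `u = u₀`. There its `u`-derivative vanishes, hence so does `Ã'`, hence the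
restriction is locally constant; so away from `u = u₀` the level sets of `ũ` are those of `u`. -/
theorem trd_apply_eq_zero (h : IsEquivalenceTransformation r I J K φ) (hr : 2 ≤ r)
    (hB : IsOpenBox I J K) (hp : p ∈ box I J K) :
    (fderiv ℝ φ p (1, 0, 0)).2.2 = 0 ∧ (fderiv ℝ φ p (0, 1, 0)).2.2 = 0 := by
  obtain ⟨u₀, hu₀, hne⟩ := exists_mem_ne hB.isOpen_K hp.2.2
  obtain ⟨x₀, hx₀⟩ := hB.nonempty_J
  obtain ⟨θ', hθ', -, hlead⟩ :=
    h.exists_image_elements hr hB (quadratic_inClass (α := 1) (γ := 0) hu₀ hx₀)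
  let π : ℝ × ℝ × ℝ → ℝ × ℝ × ℝ := fun p => (p.1, p.2.1, u₀)
  have hπ : ∀ p ∈ box I J K, π p ∈ box I J K := fun p hp => ⟨hp.1, hp.2.1, hu₀⟩
  have hl : ∀ p ∈ box I J K, θ'.G (φ p).2.1 * θ'.A (φ p).2.2 * (fderiv ℝ φ p (1, 0, 0)).1 =
      (1 + (p.2.2 - u₀) ^ 2) * (fderiv ℝ φ p (0, 1, 0)).2.1 ^ 2 := fun p hp => by
    simpa [quadratic] using hlead p hp
  have hA₀ : ∀ p ∈ box I J K, θ'.A (φ (π p)).2.2 ≠ 0 := fun p hp h0 => by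
    have := hl _ (hπ p hp)
    rw [h0, mul_zero, zero_mul] at this
    have h1 := (mul_eq_zero.1 this.symm).resolve_left (by positivity)
    exact h.snd_apply_ne_zero hr hB (hπ p hp) (pow_eq_zero_iff two_ne_zero |>.1 h1)
  have hid : ∀ p ∈ box I J K,
      θ'.A (φ p).2.2 = (1 + (p.2.2 - u₀) ^ 2) * θ'.A (φ (π p)).2.2 := by
    intro p hp
    have k₁ := hl p hp
    have k₂ := hl _ (hπ p hp)
    rw [h.snd_eq hr hB hp (hπ p hp) rfl rfl, h.fst_apply_eq hr hB hp (hπ p hp) rfl,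
      h.snd_apply_eq hr hB hp (hπ p hp) rfl rfl] at k₁
    have hG : θ'.G (φ (π p)).2.1 ≠ 0 := fun h0 => by
      rw [h0, zero_mul, zero_mul] at k₂
      have h1 := (mul_eq_zero.1 k₂.symm).resolve_left (by positivity)
      exact h.snd_apply_ne_zero hr hB (hπ p hp) (pow_eq_zero_iff two_ne_zero |>.1 h1)
    have hT := h.fst_apply_ne_zero hr hB (hπ p hp)
    refine mul_left_cancel₀ (mul_ne_zero hG hT) ?_
    simp only [π, sub_self] at k₁ k₂ ⊢
    linear_combination k₁ - (1 + (p.2.2 - u₀) ^ 2) * k₂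
  have hf : ∀ p ∈ box I J K, HasFDerivAt (fun p => θ'.A (φ p).2.2)
      (deriv θ'.A (φ p).2.2 • ((ContinuousLinearMap.snd ℝ ℝ ℝ).comp
        ((ContinuousLinearMap.snd ℝ ℝ (ℝ × ℝ)).comp (fderiv ℝ φ p)))) p := fun p hp =>
    (hθ'.differentiableAt_A h.1 hr hB.isOpen hp).hasDerivAt.comp_hasFDerivAt p
      (hasFDerivAt_snd.comp p (hasFDerivAt_snd.comp p (h.hasFDerivAt hr hB hp)))
  let π' : ℝ × ℝ × ℝ →L[ℝ] ℝ × ℝ × ℝ :=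
    (ContinuousLinearMap.fst ℝ ℝ (ℝ × ℝ)).prod
      (((ContinuousLinearMap.fst ℝ ℝ ℝ).comp (ContinuousLinearMap.snd ℝ ℝ (ℝ × ℝ))).prod 0)
  have hπ' : ∀ p, HasFDerivAt π π' p := fun p =>
    hasFDerivAt_fst.prodMk ((hasFDerivAt_fst.comp p hasFDerivAt_snd).prodMk
      (hasFDerivAt_const _ _))
  have hu : ∀ p : ℝ × ℝ × ℝ, HasFDerivAt (fun p : ℝ × ℝ × ℝ => p.2.2 - u₀)
      ((ContinuousLinearMap.snd ℝ ℝ ℝ).comp (ContinuousLinearMap.snd ℝ ℝ (ℝ × ℝ))) p := fun p =>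
    (hasFDerivAt_snd.comp p hasFDerivAt_snd).sub_const _
  -- the differential of the identity `hid`
  have hdiff : ∀ p ∈ box I J K, ∀ e, deriv θ'.A (φ p).2.2 * (fderiv ℝ φ p e).2.2 =
      2 * (p.2.2 - u₀) * e.2.2 * θ'.A (φ (π p)).2.2 + (1 + (p.2.2 - u₀) ^ 2) *
        (deriv θ'.A (φ (π p)).2.2 * (fderiv ℝ φ (π p) (π' e)).2.2) := by
    intro p hp e
    have h1 := (((hu p).pow 2).const_add 1).mul
      (HasFDerivAt.comp p (hf _ (hπ p hp)) (hπ' p))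
    have h2 := (hf p hp).congr_of_eventuallyEq (f₁ := fun p =>
      (1 + (p.2.2 - u₀) ^ 2) * θ'.A (φ (π p)).2.2) (by
        filter_upwards [hB.isOpen.mem_nhds hp] with p' hp'
        exact (hid p' hp').symm)
    have h3 := DFunLike.congr_fun (h2.unique h1) e
    simp only [smul_apply, ContinuousLinearMap.comp_apply,
      ContinuousLinearMap.coe_snd', smul_eq_mul, add_apply,
      Function.comp_apply] at h3
    rw [h3]
    simp
    ring
  have hA' : deriv θ'.A (φ (π p)).2.2 = 0 := by
    have h1 := hdiff (π p) (hπ p hp) (0, 0, 1)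
    have h2 : π' (0, 0, 1) = 0 := rfl
    have h3 : (π p).2.2 - u₀ = 0 := sub_self _
    rw [h2, h3] at h1
    simp only [map_zero, Prod.snd_zero, mul_zero, zero_mul, add_zero] at h1
    exact (mul_eq_zero.1 h1).resolve_right (h.trd_apply_ne_zero hr hB (hπ p hp))
  have h1 : ∀ e, deriv θ'.A (φ p).2.2 * (fderiv ℝ φ p e).2.2 =
      2 * (p.2.2 - u₀) * e.2.2 * θ'.A (φ (π p)).2.2 := fun e => by
    rw [hdiff p hp e, hA']
    ring
  have h2 : deriv θ'.A (φ p).2.2 ≠ 0 := fun h0 => by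
    have := h1 (0, 0, 1)
    rw [h0, zero_mul] at this
    have h3 : p.2.2 - u₀ ≠ 0 := sub_ne_zero.2 hne.symm
    have h4 := hA₀ p hp
    simp [h3, h4] at this
  exact ⟨(mul_eq_zero.1 ((h1 (1, 0, 0)).trans (by simp))).resolve_left h2,
    (mul_eq_zero.1 ((h1 (0, 1, 0)).trans (by simp))).resolve_left h2⟩

theorem trd_eq (h : IsEquivalenceTransformation r I J K φ) (hr : 2 ≤ r)
    (hB : IsOpenBox I J K) (hp : p ∈ box I J K) (hp' : p' ∈ box I J K) (hu : p.2.2 = p'.2.2) :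
    (φ p).2.2 = (φ p').2.2 := by
  refine eq_of_apply_fderiv_eq_zero hB.convex (fun _ hq => h.hasFDerivAt hr hB hq)
    ((ContinuousLinearMap.snd ℝ ℝ ℝ).comp (ContinuousLinearMap.snd ℝ ℝ (ℝ × ℝ))) hp' hp
    fun p'' hp'' => ?_
  rw [apply_eq]
  simp [hu, h.trd_apply_eq_zero hr hB hp'']

/-- Comparing the elements `A = 1`, `G = 1 + (x - x₀)²` with the elements `A = G = 1` shows that
`1 + (x - x₀)²` is a function of `x̃` times a function of `ũ`, so that `x̃` does not depend
on `t`. -/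
theorem snd_apply_eq_zero_fst (h : IsEquivalenceTransformation r I J K φ) (hr : 2 ≤ r)
    (hB : IsOpenBox I J K) (hp : p ∈ box I J K) : (fderiv ℝ φ p (1, 0, 0)).2.1 = 0 := by
  obtain ⟨x₀, hx₀, hne⟩ := exists_mem_ne hB.isOpen_J hp.2.1
  obtain ⟨u₀, hu₀⟩ := hB.nonempty_K
  obtain ⟨θ', hθ', -, hl⟩ :=
    h.exists_image_elements hr hB (quadratic_inClass (α := 0) (γ := 1) hu₀ hx₀)
  obtain ⟨θ₁, hθ₁, -, hl₁⟩ := h.exists_image_elements hr hB (heat_inClass hB)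
  simp only [quadratic, heat, zero_mul, add_zero, one_mul, mul_one] at hl hl₁
  have hne₁ : ∀ p ∈ box I J K, θ₁.G (φ p).2.1 ≠ 0 ∧ θ₁.A (φ p).2.2 ≠ 0 := fun p hp => by
    have h1 : θ₁.G (φ p).2.1 * θ₁.A (φ p).2.2 * (fderiv ℝ φ p (1, 0, 0)).1 ≠ 0 :=
      hl₁ p hp ▸ pow_ne_zero 2 (h.snd_apply_ne_zero hr hB hp)
    have h2 := left_ne_zero_of_mul h1
    exact ⟨left_ne_zero_of_mul h2, right_ne_zero_of_mul h2⟩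
  have hid : ∀ p ∈ box I J K, θ'.G (φ p).2.1 * θ'.A (φ p).2.2 =
      (1 + (p.2.1 - x₀) ^ 2) * (θ₁.G (φ p).2.1 * θ₁.A (φ p).2.2) := fun p hp => by
    refine mul_right_cancel₀ (h.fst_apply_ne_zero hr hB hp) ?_
    rw [hl p hp, mul_assoc (1 + _), hl₁ p hp]
  -- along the line in direction `e` through `p`, where `u` is constant
  have hline : ∀ e : ℝ × ℝ × ℝ, e.2.2 = 0 →
      (deriv θ'.G (φ p).2.1 * θ₁.G (φ p).2.1 - θ'.G (φ p).2.1 * deriv θ₁.G (φ p).2.1) *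
        θ'.A (φ p).2.2 * (fderiv ℝ φ p e).2.1 =
      2 * (p.2.1 - x₀) * e.2.1 * θ₁.G (φ p).2.1 ^ 2 * θ₁.A (φ p).2.2 := by
    intro e he
    have h1 : HasDerivAt (fun s : ℝ => p + s • e) e 0 := by
      simpa using ((hasDerivAt_id (0 : ℝ)).smul_const e).const_add p
    have hm : ∀ᶠ s : ℝ in 𝓝 0, p + s • e ∈ box I J K := by
      refine h1.continuousAt.eventually (hB.isOpen.mem_nhds ?_)
      simpa using hp
    have h2 : HasFDerivAt φ (fderiv ℝ φ p) (p + (0 : ℝ) • e) := by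
      simpa using h.hasFDerivAt hr hB hp
    have h3 : HasDerivAt (fun s : ℝ => (φ (p + s • e)).2.1) (fderiv ℝ φ p e).2.1 0 :=
      ((ContinuousLinearMap.fst ℝ ℝ ℝ).comp
        (ContinuousLinearMap.snd ℝ ℝ (ℝ × ℝ))).hasFDerivAt.comp_hasDerivAt (0 : ℝ)
          (h2.comp_hasDerivAt (0 : ℝ) h1)
    have hG' : DifferentiableAt ℝ θ'.G (φ (p + (0 : ℝ) • e)).2.1 := by
      simpa using hθ'.differentiableAt_G h.1 hr hB.isOpen hp
    have hG₁ : DifferentiableAt ℝ θ₁.G (φ (p + (0 : ℝ) • e)).2.1 := by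
      simpa using hθ₁.differentiableAt_G h.1 hr hB.isOpen hp
    have h4 := HasDerivAt.comp (0 : ℝ) (h₂ := θ'.G) (h := fun s : ℝ => (φ (p + s • e)).2.1)
      hG'.hasDerivAt h3
    have h5 := HasDerivAt.comp (0 : ℝ) (h₂ := θ₁.G) (h := fun s : ℝ => (φ (p + s • e)).2.1)
      hG₁.hasDerivAt h3
    have h6 : HasDerivAt (fun s : ℝ => p.2.1 + s * e.2.1 - x₀) e.2.1 0 := by
      simpa using ((((hasDerivAt_id (0 : ℝ)).mul_const e.2.1).const_add p.2.1).sub_const x₀)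
    have h7 := (((h6.pow 2).const_add 1).mul (h5.mul_const (θ₁.A (φ p).2.2)))
    have h8 := (h4.mul_const (θ'.A (φ p).2.2)).congr_of_eventuallyEq (f₁ := fun s : ℝ =>
      (1 + (p.2.1 + s * e.2.1 - x₀) ^ 2) * (θ₁.G (φ (p + s • e)).2.1 * θ₁.A (φ p).2.2)) (by
        filter_upwards [hm] with s hs
        have := hid _ hs
        rw [h.trd_eq hr hB hs hp (by simp [he])] at this
        simpa using this.symm)
    have h9 := h8.unique h7
    have h10 := hid p hp
    simp only [Function.comp_apply, zero_smul, add_zero, zero_mul] at h9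
    have hs : (1 : ℝ) + (p.2.1 - x₀) ^ 2 ≠ 0 := by positivity
    push_cast at h9
    simp at h9
    linear_combination θ₁.G (φ p).2.1 * h9 -
      deriv θ₁.G (φ p).2.1 * (fderiv ℝ φ p e).2.1 * h10
  have hx := hline (0, 1, 0) rfl
  have ht := hline (1, 0, 0) rfl
  refine (mul_eq_zero.1 (ht.trans (by simp))).resolve_left fun h0 => ?_
  rw [h0, zero_mul] at hx
  have h3 : p.2.1 - x₀ ≠ 0 := sub_ne_zero.2 hne.symm
  simp [h3, hne₁ p hp] at hx

theorem snd_eq_of_snd_eq (h : IsEquivalenceTransformation r I J K φ) (hr : 2 ≤ r)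
    (hB : IsOpenBox I J K) (hp : p ∈ box I J K) (hp' : p' ∈ box I J K) (hx : p.2.1 = p'.2.1) :
    (φ p).2.1 = (φ p').2.1 := by
  refine eq_of_apply_fderiv_eq_zero hB.convex (fun _ hq => h.hasFDerivAt hr hB hq)
    ((ContinuousLinearMap.fst ℝ ℝ ℝ).comp (ContinuousLinearMap.snd ℝ ℝ (ℝ × ℝ))) hp' hp
    fun p'' hp'' => ?_
  rw [apply_eq]
  simp [hx, h.snd_apply_eq_zero hr hB hp'', h.snd_apply_eq_zero_fst hr hB hp'']

/-- In `G̃ Ã T_t = X_x²` for the elements `A = G = 1`, everything but `T_t` is independent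
of `t`. -/
theorem fst_apply_const (h : IsEquivalenceTransformation r I J K φ) (hr : 2 ≤ r)
    (hB : IsOpenBox I J K) (hp : p ∈ box I J K) (hp' : p' ∈ box I J K) :
    (fderiv ℝ φ p (1, 0, 0)).1 = (fderiv ℝ φ p' (1, 0, 0)).1 := by
  obtain ⟨θ', -, -, hl⟩ := h.exists_image_elements hr hB (heat_inClass hB)
  simp only [heat, mul_one, one_mul] at hl
  have hm : (p.1, p'.2.1, p'.2.2) ∈ box I J K := ⟨hp.1, hp'.2.1, hp'.2.2⟩
  rw [h.fst_apply_eq hr hB hp hm rfl]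
  have k₁ := hl _ hm
  have k₂ := hl _ hp'
  have hX : (fderiv ℝ φ (p.1, p'.2.1, p'.2.2) (0, 1, 0)).2.1 = (fderiv ℝ φ p' (0, 1, 0)).2.1 :=
    apply_fderiv_eq hB.isOpen (fun _ hq => h.hasFDerivAt hr hB hq)
      ((ContinuousLinearMap.fst ℝ ℝ ℝ).comp (ContinuousLinearMap.snd ℝ ℝ (ℝ × ℝ))) hm hp'
        fun s h₁ h₂ => h.snd_eq_of_snd_eq hr hB h₁ h₂ (by simp)
  rw [h.snd_eq_of_snd_eq hr hB hm hp' rfl, h.trd_eq hr hB hm hp' rfl, hX, ← k₂] at k₁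
  refine mul_left_cancel₀ (left_ne_zero_of_mul (b := (fderiv ℝ φ p' (1, 0, 0)).1) ?_) k₁
  rw [k₂]
  exact pow_ne_zero 2 (h.snd_apply_ne_zero hr hB hp')

end IsEquivalenceTransformation

/-! ### Affinity of the separated transformation -/

/-- Under a separated transformation that is affine in `t`, linear functions of `x`, which solve
the heat equation, have images solving the transformed equation only if the transformation is
affine in `x` and in `u`. -/
theorem MapsEquation.deriv_deriv_eq_zero {Ω : Set (ℝ × ℝ × ℝ)} {φ : ℝ × ℝ × ℝ → ℝ × ℝ × ℝ}
    {θ' : Elements} (hΩ : IsOpen Ω) (hmap : MapsEquation Ω φ heat θ') {α τ : ℝ} {ξ μ : ℝ → ℝ}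
    {t x z : ℝ} (hp : (t, x, z) ∈ Ω) (hα : α ≠ 0)
    (hφ : ∀ p ∈ Ω, φ p = (α * p.1 + τ, ξ p.2.1, μ p.2.2))
    (hξ : ContDiffAt ℝ 2 ξ x) (hμ : ContDiffAt ℝ 2 μ z)
    (hξ₀ : deriv ξ x ≠ 0)
    (hG : DifferentiableAt ℝ θ'.G (ξ x)) (hA : DifferentiableAt ℝ θ'.A (μ z))
    (hlead : ∀ p ∈ Ω, θ'.G (ξ p.2.1) * θ'.A (μ p.2.2) * α = deriv ξ p.2.1 ^ 2) :
    deriv (deriv ξ) x * deriv μ z = 0 ∧ deriv ξ x * deriv (deriv μ) z = 0 := by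
  have hφx : φ (t, x, z) = (α * t + τ, ξ x, μ z) := hφ _ hp
  have hev : φ =ᶠ[𝓝 (t, x, z)] fun p => (α * p.1 + τ, ξ p.2.1, μ p.2.2) := by
    filter_upwards [hΩ.mem_nhds hp] with p hp using hφ p hp
  have hφ2 : ContDiffAt ℝ 2 φ (t, x, z) := by
    refine ContDiffAt.congr_of_eventuallyEq ?_ hev
    have h1 : ContDiffAt ℝ 2 (fun p : ℝ × ℝ × ℝ => α * p.1 + τ) (t, x, z) := by fun_prop
    have h2 : ContDiffAt ℝ 2 (fun p : ℝ × ℝ × ℝ => ξ p.2.1) (t, x, z) :=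
      ContDiffAt.comp (t, x, z) (g := ξ) (f := fun p : ℝ × ℝ × ℝ => p.2.1) hξ (by fun_prop)
    have h3 : ContDiffAt ℝ 2 (fun p : ℝ × ℝ × ℝ => μ p.2.2) (t, x, z) :=
      ContDiffAt.comp (t, x, z) (g := μ) (f := fun p : ℝ × ℝ × ℝ => p.2.2) hμ (by fun_prop)
    exact h1.prodMk (h2.prodMk h3)
  have hD := (hφ2.differentiableAt (by simp)).hasFDerivAt
  have hDe : ∀ e, base (fderiv ℝ φ (t, x, z) e) = (α * e.1, deriv ξ x * e.2.1) := by
    intro e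
    have h1 : HasFDerivAt (fun p : ℝ × ℝ × ℝ => (α * p.1 + τ, ξ p.2.1))
        (baseL.comp (fderiv ℝ φ (t, x, z))) (t, x, z) := by
      refine ((hasFDerivAt_base _).comp (t, x, z) hD).congr_of_eventuallyEq ?_
      filter_upwards [hev] with p hp
      simp [hp, base]
    have h2 : HasFDerivAt (fun p : ℝ × ℝ × ℝ => (α * p.1 + τ, ξ p.2.1))
        ((α • ContinuousLinearMap.fst ℝ ℝ (ℝ × ℝ)).prod (deriv ξ x •
          ((ContinuousLinearMap.fst ℝ ℝ ℝ).comp (ContinuousLinearMap.snd ℝ ℝ (ℝ × ℝ)))))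
        (t, x, z) := by
      refine ((hasFDerivAt_fst.const_mul α).add_const τ).prodMk ?_
      exact HasDerivAt.comp_hasFDerivAt (t, x, z) (h₂ := ξ) (f := fun p : ℝ × ℝ × ℝ => p.2.1)
        (hξ.differentiableAt (by simp)).hasDerivAt
        (hasFDerivAt_fst.comp (t, x, z) hasFDerivAt_snd)
    have h3 := DFunLike.congr_fun (h1.unique h2) e
    simpa using h3
  suffices hb : ∀ b, (deriv (deriv ξ) x * deriv μ z + deriv ξ x * (deriv (deriv μ) z * b)) * b =
      -(θ'.W (α * t + τ) * α * deriv ξ x) by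
    have b₀ := hb 0
    have b₁ := hb 1
    have b₂ := hb (-1)
    constructor
    · linear_combination (b₁ - b₂) / 2
    · linear_combination (b₁ + b₂) / 2 - b₀
  intro b
  have hJ : baseJacobian (fderiv ℝ φ (t, x, z)) 0 b ≠ 0 := by
    have e₁ := hDe (1, 0, 0)
    have e₂ := hDe (0, 1, b)
    simp only [base, Prod.mk.injEq, mul_one, mul_zero] at e₁ e₂
    rw [baseJacobian, e₁.1, e₁.2, e₂.1, e₂.2]
    simpa using ⟨hα, hξ₀⟩
  obtain ⟨e, he, -, -, -⟩ := exists_equiv_of_baseJacobian_ne_zero hJ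
  have hu : ContDiffAt ℝ 2 (jetFn (t, x) z 0 b 0 0) (t, x) := (contDiff_jetFn ..).contDiffAt
  obtain ⟨v, hv, himg⟩ := exists_image (by simpa using hφ2) (by simpa using hD) hu
    (hasFDerivAt_jetFn ..) he
  have hm := (hmap _ v (t, x) (by simpa using hp) hu hv himg).1
    (heat_equationAt_jetFn.2 (by norm_num))
  rw [graphPt_jetFn] at hm hv
  simp only [hφx, base] at hm hv
  have hΩu : ∀ᶠ q' in 𝓝 (t, x), graphPt (jetFn (t, x) z 0 b 0 0) q' ∈ Ω :=
    (contDiffAt_graphPt hu).continuousAt.eventually (hΩ.mem_nhds (by simpa using hp))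
  have hvu : ∀ᶠ q' in 𝓝 (t, x), v (α * q'.1 + τ, ξ q'.2) = μ (z + b * (q'.2 - x)) := by
    filter_upwards [himg, hΩu] with q' h1 h2
    rw [hφ _ h2] at h1
    simpa [graphPt, base, jetFn] using h1
  have hv₀ : v (α * t + τ, ξ x) = μ z := by simpa using hvu.self_of_nhds
  -- the image does not depend on the new time
  have hvT : deriv (fun s => v (s, ξ x)) (α * t + τ) = 0 := by
    have l : HasDerivAt (fun s : ℝ => α * s + τ) α t := by
      simpa using ((hasDerivAt_id t).const_mul α).add_const τ
    have k : DifferentiableAt ℝ (fun s => v (s, ξ x)) (α * t + τ) :=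
      DifferentiableAt.comp (α * t + τ) (g := v) (f := fun s => (s, ξ x))
        (hv.differentiableAt (by simp)) (by fun_prop)
    have h1 : HasDerivAt (fun s => v (α * s + τ, ξ x)) _ t :=
      HasDerivAt.comp t (h₂ := fun s => v (s, ξ x)) k.hasDerivAt l
    have c : Tendsto (fun s : ℝ => (s, x)) (𝓝 t) (𝓝 (t, x)) := by
      have : Continuous fun s : ℝ => (s, x) := by fun_prop
      exact this.continuousAt
    have h2 := (hasDerivAt_const t (μ z)).congr_of_eventuallyEq
      (f₁ := fun s => v (α * s + τ, ξ x)) (by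
        filter_upwards [c.eventually hvu] with s hs
        simpa using hs)
    exact (mul_eq_zero.1 (h1.unique h2)).resolve_right hα
  unfold Elements.EquationAt at hm
  simp only [hvT] at hm
  -- the flux, as a function of the old variable `x`
  set k : ℝ → ℝ := fun y => v (α * t + τ, y) with hk
  have hk2 : ContDiffAt ℝ 2 k (ξ x) :=
    ContDiffAt.comp (ξ x) (g := v) hv (by fun_prop)
  set F : ℝ → ℝ := fun y => θ'.G y * θ'.A (k y) * deriv k y with hF
  have hFd : DifferentiableAt ℝ F (ξ x) := by
    have hAk : DifferentiableAt ℝ (fun y => θ'.A (k y)) (ξ x) :=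
      DifferentiableAt.comp (ξ x) (g := θ'.A) (by rw [hk]; simpa only [hv₀] using hA)
        (hk2.differentiableAt (by simp))
    exact (hG.mul hAk).mul ((contDiffAt_deriv hk2).differentiableAt (by simp))
  have hξd := (hξ.differentiableAt (by simp)).hasDerivAt
  have c : Tendsto (fun y : ℝ => (t, y)) (𝓝 x) (𝓝 (t, x)) := by
    have : Continuous fun y : ℝ => (t, y) := by fun_prop
    exact this.continuousAt
  have hkξ : ∀ᶠ y in 𝓝 x, k (ξ y) = μ (z + b * (y - x)) := c.eventually hvu
  have hl : ∀ y, HasDerivAt (fun y => z + b * (y - x)) b y := fun y => by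
    simpa using (((hasDerivAt_id y).sub_const x).const_mul b).const_add z
  have hlt : Tendsto (fun y => z + b * (y - x)) (𝓝 x) (𝓝 z) := by
    simpa using (hl x).continuousAt.tendsto
  have hFξ : (fun y => F (ξ y)) =ᶠ[𝓝 x]
      fun y => deriv ξ y * deriv μ (z + b * (y - x)) * b / α := by
    have hne : ∀ᶠ y in 𝓝 x, deriv ξ y ≠ 0 :=
      (contDiffAt_deriv hξ).continuousAt.eventually_ne hξ₀
    filter_upwards [hkξ.eventually_nhds, hne, eventually_differentiableAt hξ,
      hξd.continuousAt.eventually (eventually_differentiableAt hk2),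
      hlt.eventually (eventually_differentiableAt hμ), c.eventually hΩu] with y h1 h2 h3 h4 h5 h6
    have d1 : HasDerivAt (fun y => k (ξ y)) _ y :=
      HasDerivAt.comp y (h₂ := k) h4.hasDerivAt h3.hasDerivAt
    have d2 : HasDerivAt (fun y => μ (z + b * (y - x))) _ y :=
      HasDerivAt.comp y (h₂ := μ) (h := fun y => z + b * (y - x)) h5.hasDerivAt (hl y)
    have d3 := d1.unique (d2.congr_of_eventuallyEq h1)
    have h7 := hlead _ h6
    simp only [graphPt, jetFn, sub_self, mul_zero, add_zero, zero_mul] at h7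
    rw [hF]
    simp only [h1.self_of_nhds]
    rw [eq_div_iff hα]
    refine mul_right_cancel₀ h2 ?_
    linear_combination θ'.G (ξ y) * θ'.A (μ (z + b * (y - x))) * α * d3 +
      deriv μ (z + b * (y - x)) * b * h7
  have D1 : HasDerivAt (fun y => F (ξ y)) _ x :=
    HasDerivAt.comp x (h₂ := F) hFd.hasDerivAt hξd
  have hμ' : HasDerivAt (deriv μ) (deriv (deriv μ) z) (z + b * (x - x)) := by
    rw [sub_self, mul_zero, add_zero]
    exact ((contDiffAt_deriv hμ).differentiableAt (by simp)).hasDerivAt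
  have D2 : HasDerivAt (fun y => deriv μ (z + b * (y - x))) _ x :=
    HasDerivAt.comp x (h₂ := deriv μ) (h := fun y => z + b * (y - x)) hμ' (hl x)
  have D3 := ((((contDiffAt_deriv hξ).differentiableAt (by simp)).hasDerivAt.mul D2).mul_const
    b).div_const α
  have D4 := D1.unique (D3.congr_of_eventuallyEq hFξ)
  simp only [sub_self, mul_zero, add_zero] at D4
  rw [eq_div_iff hα] at D4
  linear_combination -D4 - deriv ξ x * α * hm

theorem exists_affine_of_deriv_deriv_eq_zero {S : Set ℝ} (hS : IsOpen S) (hS' : S.OrdConnected)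
    {f : ℝ → ℝ} (hf : ∀ x ∈ S, ContDiffAt ℝ 2 f x) (h : ∀ x ∈ S, deriv (deriv f) x = 0) :
    ∃ c d, ∀ x ∈ S, deriv f x = c ∧ f x = c * x + d := by
  obtain ⟨c, hc⟩ := exists_eq_mul_add hS hS' (f := deriv f) (c := 0) fun x hx =>
    h x hx ▸ ((contDiffAt_deriv (hf x hx)).differentiableAt (by simp)).hasDerivAt
  have hc' : ∀ x ∈ S, deriv f x = c := fun x hx => by simpa using hc x hx
  obtain ⟨d, hd⟩ := exists_eq_mul_add hS hS' (f := f) (c := c) fun x hx =>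
    hc' x hx ▸ ((hf x hx).differentiableAt (by simp)).hasDerivAt
  exact ⟨c, d, fun x hx => ⟨hc' x hx, hd x hx⟩⟩

theorem IsEquivalenceTransformation.exists_affine {r : WithTop ℕ∞} {I J K : Set ℝ}
    {φ : ℝ × ℝ × ℝ → ℝ × ℝ × ℝ} (h : IsEquivalenceTransformation r I J K φ) (hr : 2 ≤ r)
    (hB : IsOpenBox I J K) :
    ∃ ε₁ ε₂ ε₃ ε₄ ε₅ ε₆ : ℝ, ε₄ ≠ 0 ∧ ε₅ ≠ 0 ∧ ε₆ ≠ 0 ∧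
      ∀ t ∈ I, ∀ x ∈ J, ∀ u ∈ K,
        φ (t, x, u) = (ε₄ * t + ε₁, ε₅ * x + ε₂, ε₆ * u + ε₃) := by
  obtain ⟨t₀, ht₀⟩ := hB.nonempty_I
  obtain ⟨x₀, hx₀⟩ := hB.nonempty_J
  obtain ⟨u₀, hu₀⟩ := hB.nonempty_K
  set α := (fderiv ℝ φ (t₀, x₀, u₀) (1, 0, 0)).1 with hα
  set ξ : ℝ → ℝ := fun s => (φ (t₀, s, u₀)).2.1 with hξ
  set μ : ℝ → ℝ := fun s => (φ (t₀, x₀, s)).2.2 with hμ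
  have hα₀ : α ≠ 0 := h.fst_apply_ne_zero hr hB ⟨ht₀, hx₀, hu₀⟩
  obtain ⟨τ, hτ⟩ : ∃ τ, ∀ t ∈ I, (φ (t, x₀, u₀)).1 = α * t + τ := by
    refine exists_eq_mul_add hB.isOpen_I hB.ordConnected_I fun t ht => ?_
    have hp : (t, x₀, u₀) ∈ box I J K := ⟨ht, hx₀, hu₀⟩
    have hline : HasDerivAt (fun s : ℝ => (s, x₀, u₀)) ((1, 0, 0) : ℝ × ℝ × ℝ) t :=
      (hasDerivAt_id _).prodMk ((hasDerivAt_const _ _).prodMk (hasDerivAt_const _ _))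
    have h1 := HasFDerivAt.comp_hasDerivAt t (f := fun s : ℝ => (s, x₀, u₀))
      (h.hasFDerivAt hr hB hp) hline
    have h2 := (ContinuousLinearMap.fst ℝ ℝ (ℝ × ℝ)).hasFDerivAt.comp_hasDerivAt t h1
    rw [hα, h.fst_apply_const hr hB ⟨ht₀, hx₀, hu₀⟩ hp]
    exact h2
  have hform : ∀ p ∈ box I J K, φ p = (α * p.1 + τ, ξ p.2.1, μ p.2.2) := fun p hp =>
    Prod.ext ((h.fst_eq hr hB hp (p' := (p.1, x₀, u₀)) ⟨hp.1, hx₀, hu₀⟩ rfl).trans (hτ _ hp.1))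
      (Prod.ext (h.snd_eq_of_snd_eq hr hB hp (p' := (t₀, p.2.1, u₀)) ⟨ht₀, hp.2.1, hu₀⟩ rfl)
        (h.trd_eq hr hB hp (p' := (t₀, x₀, p.2.2)) ⟨ht₀, hx₀, hp.2.2⟩ rfl))
  have hξ2 : ∀ x ∈ J, ContDiffAt ℝ 2 ξ x := fun x hx =>
    ContDiffAt.comp x (g := fun p : ℝ × ℝ × ℝ => p.2.1) (f := fun s => φ (t₀, s, u₀)) (by fun_prop)
      (ContDiffAt.comp x (g := φ) (f := fun s => (t₀, s, u₀))
        (h.1.contDiffAt hr hB.isOpen ⟨ht₀, hx, hu₀⟩) (by fun_prop))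
  have hμ2 : ∀ u ∈ K, ContDiffAt ℝ 2 μ u := fun u hu =>
    ContDiffAt.comp u (g := fun p : ℝ × ℝ × ℝ => p.2.2) (f := fun s => φ (t₀, x₀, s)) (by fun_prop)
      (ContDiffAt.comp u (g := φ) (f := fun s => (t₀, x₀, s))
        (h.1.contDiffAt hr hB.isOpen ⟨ht₀, hx₀, hu⟩) (by fun_prop))
  have hξd : ∀ p ∈ box I J K, (fderiv ℝ φ p (0, 1, 0)).2.1 = deriv ξ p.2.1 := by
    rintro ⟨t, x, u⟩ hp
    have hline : HasDerivAt (fun s : ℝ => (t, s, u)) ((0, 1, 0) : ℝ × ℝ × ℝ) x :=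
      (hasDerivAt_const _ _).prodMk ((hasDerivAt_id _).prodMk (hasDerivAt_const _ _))
    have h1 := HasFDerivAt.comp_hasDerivAt x (f := fun s : ℝ => (t, s, u))
      (h.hasFDerivAt hr hB hp) hline
    have h2 := ((ContinuousLinearMap.fst ℝ ℝ ℝ).comp
      (ContinuousLinearMap.snd ℝ ℝ (ℝ × ℝ))).hasFDerivAt.comp_hasDerivAt x h1
    refine (h2.congr_of_eventuallyEq ?_).deriv.symm
    filter_upwards [hB.isOpen_J.mem_nhds hp.2.1] with s hs
    exact (h.snd_eq_of_snd_eq hr hB (p := (t, s, u)) (p' := (t₀, s, u₀)) ⟨hp.1, hs, hp.2.2⟩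
      ⟨ht₀, hs, hu₀⟩ rfl).symm
  have hμd : ∀ u ∈ K, deriv μ u ≠ 0 := by
    intro u hu
    have hp : (t₀, x₀, u) ∈ box I J K := ⟨ht₀, hx₀, hu⟩
    have hline : HasDerivAt (fun s : ℝ => (t₀, x₀, s)) ((0, 0, 1) : ℝ × ℝ × ℝ) u :=
      (hasDerivAt_const _ _).prodMk ((hasDerivAt_const _ _).prodMk (hasDerivAt_id _))
    have h1 := HasFDerivAt.comp_hasDerivAt u (f := fun s : ℝ => (t₀, x₀, s))
      (h.hasFDerivAt hr hB hp) hline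
    have h2 : HasDerivAt μ _ u := ((ContinuousLinearMap.snd ℝ ℝ ℝ).comp
      (ContinuousLinearMap.snd ℝ ℝ (ℝ × ℝ))).hasFDerivAt.comp_hasDerivAt u h1
    rw [h2.deriv]
    exact h.trd_apply_ne_zero hr hB hp
  have hξ₀ : ∀ x ∈ J, deriv ξ x ≠ 0 := fun x hx =>
    hξd (t₀, x, u₀) ⟨ht₀, hx, hu₀⟩ ▸ h.snd_apply_ne_zero hr hB ⟨ht₀, hx, hu₀⟩
  obtain ⟨θ', hθ', hmap, hl⟩ := h.exists_image_elements hr hB (heat_inClass hB)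
  have hlead : ∀ p ∈ box I J K, θ'.G (ξ p.2.1) * θ'.A (μ p.2.2) * α = deriv ξ p.2.1 ^ 2 := by
    intro p hp
    have := hl p hp
    rw [hform p hp, hξd p hp, h.fst_apply_const hr hB hp (p' := (t₀, x₀, u₀)) ⟨ht₀, hx₀, hu₀⟩,
      ← hα] at this
    simpa [heat] using this
  have hzero : ∀ x ∈ J, ∀ u ∈ K,
      deriv (deriv ξ) x * deriv μ u = 0 ∧ deriv ξ x * deriv (deriv μ) u = 0 := by
    intro x hx u hu
    have hp : (t₀, x, u) ∈ box I J K := ⟨ht₀, hx, hu⟩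
    have hG := hθ'.differentiableAt_G h.1 hr hB.isOpen hp
    have hA := hθ'.differentiableAt_A h.1 hr hB.isOpen hp
    rw [hform _ hp] at hG hA
    exact hmap.deriv_deriv_eq_zero hB.isOpen hp hα₀ hform (hξ2 x hx) (hμ2 u hu) (hξ₀ x hx) hG hA
      hlead
  obtain ⟨ε₅, ε₂, h₅⟩ := exists_affine_of_deriv_deriv_eq_zero hB.isOpen_J hB.ordConnected_J hξ2
    fun x hx => (mul_eq_zero.1 (hzero x hx u₀ hu₀).1).resolve_right (hμd u₀ hu₀)
  obtain ⟨ε₆, ε₃, h₆⟩ := exists_affine_of_deriv_deriv_eq_zero hB.isOpen_K hB.ordConnected_K hμ2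
    fun u hu => (mul_eq_zero.1 (hzero x₀ hx₀ u hu).2).resolve_left (hξ₀ x₀ hx₀)
  refine ⟨τ, ε₂, ε₃, α, ε₅, ε₆, hα₀, (h₅ x₀ hx₀).1 ▸ hξ₀ x₀ hx₀, (h₆ u₀ hu₀).1 ▸ hμd u₀ hu₀,
    fun t ht x hx u hu => ?_⟩
  rw [hform _ ⟨ht, hx, hu⟩, (h₅ x hx).2, (h₆ u hu).2]

/-! ### Affine transformations -/

/-- `φ` is given on the box by `t̃ = ε₄ t + ε₁`, `x̃ = ε₅ x + ε₂`, `ũ = ε₆ u + ε₃` with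
non-zero `ε₄`, `ε₅`, `ε₆`. -/
structure IsAffineOn (I J K : Set ℝ) (φ : ℝ × ℝ × ℝ → ℝ × ℝ × ℝ) (ε₁ ε₂ ε₃ ε₄ ε₅ ε₆ : ℝ) :
    Prop where
  ne₄ : ε₄ ≠ 0
  ne₅ : ε₅ ≠ 0
  ne₆ : ε₆ ≠ 0
  eq : ∀ t ∈ I, ∀ x ∈ J, ∀ u ∈ K, φ (t, x, u) = (ε₄ * t + ε₁, ε₅ * x + ε₂, ε₆ * u + ε₃)

theorem deriv_eq_of_eventuallyEq_affine {f g : ℝ → ℝ} {x α β γ δ : ℝ}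
    (h : (fun s => f (α * s + β)) =ᶠ[𝓝 x] fun s => γ * g s + δ) :
    α * deriv f (α * x + β) = γ * deriv g x := by
  have h1 : deriv (fun s => f (α * s + β)) x = α * deriv f (α * x + β) := by
    have := deriv_comp_mul_left α (fun y => f (y + β)) x
    rwa [deriv_comp_add_const, smul_eq_mul] at this
  rw [← h1, h.deriv_eq, deriv_add_const, deriv_const_mul_field]

/-- The elements obtained from `θ` by an affine transformation. -/
noncomputable def Elements.transform (θ : Elements)
    (ε₁ ε₂ ε₃ ε₄ ε₅ ε₆ ε₇ : ℝ) : Elements where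
  A y := ε₇ * θ.A ((y - ε₃) / ε₆)
  G y := ε₄⁻¹ * ε₅ ^ 2 * ε₇⁻¹ * θ.G ((y - ε₂) / ε₅)
  W y := ε₄⁻¹ * ε₆ * θ.W ((y - ε₁) / ε₄)

namespace IsAffineOn

variable {r : WithTop ℕ∞} {I J K : Set ℝ} {φ : ℝ × ℝ × ℝ → ℝ × ℝ × ℝ} {ε₁ ε₂ ε₃ ε₄ ε₅ ε₆ : ℝ}

theorem isPointTransformation (h : IsAffineOn I J K φ ε₁ ε₂ ε₃ ε₄ ε₅ ε₆)
    (hB : IsOpenBox I J K) : IsPointTransformation r (box I J K) φ where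
  contDiffOn := by
    have : ContDiff ℝ r fun p : ℝ × ℝ × ℝ => (ε₄ * p.1 + ε₁, ε₅ * p.2.1 + ε₂, ε₆ * p.2.2 + ε₃) := by
      fun_prop
    exact this.contDiffOn.congr fun p hp => h.eq _ hp.1 _ hp.2.1 _ hp.2.2
  injOn := by
    rintro ⟨t, x, u⟩ ⟨ht, hx, hu⟩ ⟨t', x', u'⟩ ⟨ht', hx', hu'⟩ heq
    rw [h.eq _ ht _ hx _ hu, h.eq _ ht' _ hx' _ hu'] at heq
    simpa [h.ne₄, h.ne₅, h.ne₆] using heq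
  isInvertible_fderiv := fun p hp => by
    let D : ℝ → ℝ → ℝ → ℝ × ℝ × ℝ →L[ℝ] ℝ × ℝ × ℝ := fun a b c =>
      (a • ContinuousLinearMap.fst ℝ ℝ (ℝ × ℝ)).prod
        ((b • (ContinuousLinearMap.fst ℝ ℝ ℝ).comp (ContinuousLinearMap.snd ℝ ℝ (ℝ × ℝ))).prod
          (c • (ContinuousLinearMap.snd ℝ ℝ ℝ).comp (ContinuousLinearMap.snd ℝ ℝ (ℝ × ℝ))))
    have hD : ∀ a b c p, D a b c p = (a * p.1, b * p.2.1, c * p.2.2) := fun a b c p => by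
      simp [D]
    have h1 : HasFDerivAt (fun p => D ε₄ ε₅ ε₆ p + (ε₁, ε₂, ε₃)) (D ε₄ ε₅ ε₆) p :=
      (D ε₄ ε₅ ε₆).hasFDerivAt.add_const _
    have h2 : HasFDerivAt φ (D ε₄ ε₅ ε₆) p := by
      refine h1.congr_of_eventuallyEq ?_
      filter_upwards [hB.isOpen.mem_nhds hp] with p' hp'
      rw [hD]
      exact h.eq _ hp'.1 _ hp'.2.1 _ hp'.2.2
    rw [h2.fderiv]
    refine ContinuousLinearMap.IsInvertible.of_inverse (g := D ε₄⁻¹ ε₅⁻¹ ε₆⁻¹) ?_ ?_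
    · refine ContinuousLinearMap.ext fun p => ?_
      rw [ContinuousLinearMap.comp_apply, hD, hD]
      simp [h.ne₄, h.ne₅, h.ne₆]
    · refine ContinuousLinearMap.ext fun p => ?_
      rw [ContinuousLinearMap.comp_apply, hD, hD]
      simp [h.ne₄, h.ne₅, h.ne₆]

/-- The transformed equation, in terms of the jet of the original function. -/
theorem equationAt_iff (h : IsAffineOn I J K φ ε₁ ε₂ ε₃ ε₄ ε₅ ε₆) (hB : IsOpenBox I J K)
    {θ' : Elements} {u v : ℝ × ℝ → ℝ} {t x : ℝ} (hp : graphPt u (t, x) ∈ box I J K)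
    (hu : ContDiffAt ℝ 2 u (t, x)) (hv : ContDiffAt ℝ 2 v (base (φ (graphPt u (t, x)))))
    (himg : IsImageAt φ u v (t, x))
    (hG : DifferentiableAt ℝ θ'.G (ε₅ * x + ε₂))
    (hA : DifferentiableAt ℝ θ'.A (ε₆ * u (t, x) + ε₃)) :
    θ'.EquationAt v (base (φ (graphPt u (t, x)))) ↔
      ε₄⁻¹ * ε₆ * deriv (fun s => u (s, x)) t =
        deriv θ'.G (ε₅ * x + ε₂) * θ'.A (ε₆ * u (t, x) + ε₃) *
          (ε₅⁻¹ * ε₆ * deriv (fun y => u (t, y)) x) +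
        θ'.G (ε₅ * x + ε₂) * deriv θ'.A (ε₆ * u (t, x) + ε₃) *
          (ε₅⁻¹ * ε₆ * deriv (fun y => u (t, y)) x) ^ 2 +
        θ'.G (ε₅ * x + ε₂) * θ'.A (ε₆ * u (t, x) + ε₃) *
          (ε₅⁻¹ ^ 2 * ε₆ * deriv (deriv fun y => u (t, y)) x) + θ'.W (ε₄ * t + ε₁) := by
  have hφ : φ (graphPt u (t, x)) = (ε₄ * t + ε₁, ε₅ * x + ε₂, ε₆ * u (t, x) + ε₃) :=
    h.eq _ hp.1 _ hp.2.1 _ hp.2.2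
  have hΩ : ∀ᶠ q' in 𝓝 (t, x), graphPt u q' ∈ box I J K :=
    (contDiffAt_graphPt hu).continuousAt.eventually (hB.isOpen.mem_nhds hp)
  have hev : ∀ᶠ q' in 𝓝 (t, x), v (ε₄ * q'.1 + ε₁, ε₅ * q'.2 + ε₂) = ε₆ * u q' + ε₃ := by
    filter_upwards [himg, hΩ] with q' h1 h2
    have h3 : φ (graphPt u q') = (ε₄ * q'.1 + ε₁, ε₅ * q'.2 + ε₂, ε₆ * u q' + ε₃) :=
      h.eq _ h2.1 _ h2.2.1 _ h2.2.2
    rw [h3] at h1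
    exact h1
  have hv₀ : v (ε₄ * t + ε₁, ε₅ * x + ε₂) = ε₆ * u (t, x) + ε₃ := hev.self_of_nhds
  have cT : Tendsto (fun s : ℝ => (s, x)) (𝓝 t) (𝓝 (t, x)) := by
    have : Continuous fun s : ℝ => (s, x) := by fun_prop
    exact this.continuousAt
  have cX : Tendsto (fun s : ℝ => (t, s)) (𝓝 x) (𝓝 (t, x)) := by
    have : Continuous fun s : ℝ => (t, s) := by fun_prop
    exact this.continuousAt
  have hT := deriv_eq_of_eventuallyEq_affine (f := fun s => v (s, ε₅ * x + ε₂))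
    (g := fun s => u (s, x)) (cT.eventually hev)
  have hX := (cX.eventually hev).eventually_nhds.mono fun y hy =>
    deriv_eq_of_eventuallyEq_affine (f := fun s => v (ε₄ * t + ε₁, s))
      (g := fun s => u (t, s)) hy
  have hXX := deriv_eq_of_eventuallyEq_affine (x := x) (α := ε₅) (β := ε₂) (γ := ε₅⁻¹ * ε₆)
    (δ := 0) (f := deriv fun s => v (ε₄ * t + ε₁, s)) (g := deriv fun s => u (t, s)) (by
      filter_upwards [hX] with y hy
      rw [mul_assoc, ← hy, ← mul_assoc, inv_mul_cancel₀ h.ne₅]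
      ring)
  have eT : deriv (fun s => v (s, ε₅ * x + ε₂)) (ε₄ * t + ε₁) =
      ε₄⁻¹ * ε₆ * deriv (fun s => u (s, x)) t := by
    rw [mul_assoc, ← hT, ← mul_assoc, inv_mul_cancel₀ h.ne₄, one_mul]
  have eX : deriv (fun s => v (ε₄ * t + ε₁, s)) (ε₅ * x + ε₂) =
      ε₅⁻¹ * ε₆ * deriv (fun s => u (t, s)) x := by
    rw [mul_assoc, ← hX.self_of_nhds, ← mul_assoc, inv_mul_cancel₀ h.ne₅, one_mul]
  have eXX : deriv (deriv fun s => v (ε₄ * t + ε₁, s)) (ε₅ * x + ε₂) =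
      ε₅⁻¹ ^ 2 * ε₆ * deriv (deriv fun s => u (t, s)) x := by
    rw [pow_two, mul_assoc ε₅⁻¹, mul_assoc ε₅⁻¹, ← hXX, ← mul_assoc, inv_mul_cancel₀ h.ne₅,
      one_mul]
  rw [hφ] at hv ⊢
  simp only [base] at hv ⊢
  rw [Elements.equationAt_iff hv hG (by rwa [hv₀])]
  simp only [eT, eX, eXX, hv₀]

variable {θ θ' : Elements}

/-- The leading factor `ε₄⁻¹ ε₆` is common to all terms of the transformed equation. -/
theorem mapsEquation_of_eq (h : IsAffineOn I J K φ ε₁ ε₂ ε₃ ε₄ ε₅ ε₆) (hr : 2 ≤ r)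
    (hB : IsOpenBox I J K) (hθ : θ.InClass r I J K) (hθ' : θ'.InImageClass r (box I J K) φ)
    {ε₇ : ℝ} (h₇ : ε₇ ≠ 0) (hA : ∀ u ∈ K, θ'.A (ε₆ * u + ε₃) = ε₇ * θ.A u)
    (hG : ∀ x ∈ J, θ'.G (ε₅ * x + ε₂) = ε₄⁻¹ * ε₅ ^ 2 * ε₇⁻¹ * θ.G x)
    (hW : ∀ t ∈ I, θ'.W (ε₄ * t + ε₁) = ε₄⁻¹ * ε₆ * θ.W t) :
    MapsEquation (box I J K) φ θ θ' := by
  have hr' : r ≠ 0 := by rintro rfl; simp at hr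
  rintro u v ⟨t, x⟩ hp hu hv himg
  have ht : t ∈ I := hp.1
  have hx : x ∈ J := hp.2.1
  have hz : u (t, x) ∈ K := hp.2.2
  have hφ : φ (graphPt u (t, x)) = (ε₄ * t + ε₁, ε₅ * x + ε₂, ε₆ * u (t, x) + ε₃) :=
    h.eq _ ht _ hx _ hz
  have dG := hθ'.differentiableAt_G (h.isPointTransformation hB) hr hB.isOpen hp
  have dA := hθ'.differentiableAt_A (h.isPointTransformation hB) hr hB.isOpen hp
  rw [hφ] at dG dA
  rw [h.equationAt_iff hB hp hu hv himg dG dA, Elements.equationAt_iff hu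
    ((hθ.contDiffOn_G.contDiffAt (hB.isOpen_J.mem_nhds hx)).differentiableAt hr')
    ((hθ.contDiffOn_A.contDiffAt (hB.isOpen_K.mem_nhds hz)).differentiableAt hr')]
  have eG := deriv_eq_of_eventuallyEq_affine (δ := 0) (f := θ'.G) (g := θ.G) (x := x) (by
    filter_upwards [hB.isOpen_J.mem_nhds hx] with y hy
    rw [hG y hy, add_zero])
  have eA := deriv_eq_of_eventuallyEq_affine (δ := 0) (f := θ'.A) (g := θ.A) (x := u (t, x)) (by
    filter_upwards [hB.isOpen_K.mem_nhds hz] with y hy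
    rw [hA y hy, add_zero])
  have h₄ := h.ne₄
  have h₅ := h.ne₅
  have h₆ := h.ne₆
  have eG' : deriv θ'.G (ε₅ * x + ε₂) = ε₄⁻¹ * ε₅ * ε₇⁻¹ * deriv θ.G x := by
    refine mul_left_cancel₀ h₅ ?_
    rw [eG]
    ring
  have eA' : deriv θ'.A (ε₆ * u (t, x) + ε₃) = ε₆⁻¹ * ε₇ * deriv θ.A (u (t, x)) := by
    refine mul_left_cancel₀ h₆ ?_
    rw [eA]
    field_simp
  rw [eG', eA', hA _ hz, hG _ hx, hW _ ht]
  constructor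
  · intro heq
    simp only [heq]
    field_simp
  · intro heq
    refine mul_left_cancel₀ (mul_ne_zero (inv_ne_zero h₄) h₆) (heq.trans ?_)
    simp only
    field_simp

/-- The product `G̃ Ã` is a constant multiple of `G A`; fixing a point where `G A ≠ 0` separates the
two factors and defines `ε₇`. -/
theorem mapsEquation_iff (h : IsAffineOn I J K φ ε₁ ε₂ ε₃ ε₄ ε₅ ε₆) (hr : 2 ≤ r)
    (hB : IsOpenBox I J K) (hθ : θ.InClass r I J K) (hθ' : θ'.InImageClass r (box I J K) φ) :
    MapsEquation (box I J K) φ θ θ' ↔ ∃ ε₇ : ℝ, ε₇ ≠ 0 ∧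
      (∀ u ∈ K, θ'.A (ε₆ * u + ε₃) = ε₇ * θ.A u) ∧
      (∀ x ∈ J, θ'.G (ε₅ * x + ε₂) = ε₄⁻¹ * ε₅ ^ 2 * ε₇⁻¹ * θ.G x) ∧
      (∀ t ∈ I, θ'.W (ε₄ * t + ε₁) = ε₄⁻¹ * ε₆ * θ.W t) := by
  refine ⟨fun hmap => ?_, fun ⟨ε₇, h₇, hA, hG, hW⟩ =>
    h.mapsEquation_of_eq hr hB hθ hθ' h₇ hA hG hW⟩
  have hr' : r ≠ 0 := by rintro rfl; simp at hr
  have h₄ := h.ne₄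
  have h₅ := h.ne₅
  have h₆ := h.ne₆
  -- jets with `u_x = 0`
  have key : ∀ t ∈ I, ∀ x ∈ J, ∀ z ∈ K, ∀ c,
      ε₄⁻¹ * ε₆ * (θ.G x * θ.A z * (2 * c) + θ.W t) =
        θ'.G (ε₅ * x + ε₂) * θ'.A (ε₆ * z + ε₃) * (ε₅⁻¹ ^ 2 * ε₆ * (2 * c)) +
          θ'.W (ε₄ * t + ε₁) := by
    intro t ht x hx z hz c
    set a := θ.G x * θ.A z * (2 * c) + θ.W t with ha
    have hu : ContDiffAt ℝ 2 (jetFn (t, x) z a 0 0 c) (t, x) := (contDiff_jetFn ..).contDiffAt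
    have hp : graphPt (jetFn (t, x) z a 0 0 c) (t, x) ∈ box I J K := by
      rw [graphPt_jetFn]
      exact ⟨ht, hx, hz⟩
    have hφ : φ (t, x, z) = (ε₄ * t + ε₁, ε₅ * x + ε₂, ε₆ * z + ε₃) := h.eq _ ht _ hx _ hz
    let v : ℝ × ℝ → ℝ := fun y =>
      ε₆ * jetFn (t, x) z a 0 0 c ((y.1 - ε₁) / ε₄, (y.2 - ε₂) / ε₅) + ε₃
    have hv : ContDiff ℝ 2 v := by
      have : ContDiff ℝ 2 fun y : ℝ × ℝ => ((y.1 - ε₁) / ε₄, (y.2 - ε₂) / ε₅) := by fun_prop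
      exact (contDiff_const.mul ((contDiff_jetFn (t, x) z a 0 0 c).comp this)).add contDiff_const
    have himg : IsImageAt φ (jetFn (t, x) z a 0 0 c) v (t, x) := by
      filter_upwards [(contDiffAt_graphPt hu).continuousAt.eventually (hB.isOpen.mem_nhds hp)]
        with q' hq'
      have h3 : φ (graphPt (jetFn (t, x) z a 0 0 c) q') = (ε₄ * q'.1 + ε₁, ε₅ * q'.2 + ε₂,
        ε₆ * jetFn (t, x) z a 0 0 c q' + ε₃) := h.eq _ hq'.1 _ hq'.2.1 _ hq'.2.2
      rw [h3]
      simp [v, base, h₄, h₅]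
    have dG := hθ'.differentiableAt_G (h.isPointTransformation hB) hr hB.isOpen hp
    have dA := hθ'.differentiableAt_A (h.isPointTransformation hB) hr hB.isOpen hp
    rw [graphPt_jetFn, hφ] at dG dA
    have hm := (hmap _ v (t, x) hp hu hv.contDiffAt himg).1
      ((Elements.equationAt_jetFn (t, x) z a 0 0 c
        ((hθ.contDiffOn_G.contDiffAt (hB.isOpen_J.mem_nhds hx)).differentiableAt hr')
        ((hθ.contDiffOn_A.contDiffAt (hB.isOpen_K.mem_nhds hz)).differentiableAt hr')).2
          (by rw [ha]; ring))
    rw [h.equationAt_iff hB hp hu hv.contDiffAt himg dG (by rwa [jetFn_self])] at hm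
    have d1 : deriv (fun s => jetFn (t, x) z a 0 0 c (s, x)) t = a :=
      deriv_jetFn_fst (t, x) z a 0 0 c
    have d2 : deriv (fun y => jetFn (t, x) z a 0 0 c (t, y)) = fun y => 0 + 2 * c * (y - x) :=
      funext fun y => deriv_jetFn_snd (t, x) z a 0 0 c y
    have d3 : deriv (fun y => 0 + 2 * c * (y - x)) x = 2 * c := by simp
    rw [d1, d2, d3, jetFn_self] at hm
    rw [hm]
    ring
  have hW : ∀ t ∈ I, θ'.W (ε₄ * t + ε₁) = ε₄⁻¹ * ε₆ * θ.W t := by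
    obtain ⟨x, hx⟩ := hB.nonempty_J
    obtain ⟨z, hz⟩ := hB.nonempty_K
    intro t ht
    have := key t ht x hx z hz 0
    linear_combination -this
  have hGA : ∀ x ∈ J, ∀ z ∈ K, θ'.G (ε₅ * x + ε₂) * θ'.A (ε₆ * z + ε₃) =
      ε₄⁻¹ * ε₅ ^ 2 * (θ.G x * θ.A z) := by
    obtain ⟨t, ht⟩ := hB.nonempty_I
    intro x hx z hz
    have h1 := key t ht x hx z hz 1
    have h0 := key t ht x hx z hz 0
    have : ε₄⁻¹ * ε₆ * (θ.G x * θ.A z) =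
        θ'.G (ε₅ * x + ε₂) * θ'.A (ε₆ * z + ε₃) * (ε₅⁻¹ ^ 2 * ε₆) := by
      linear_combination (h1 - h0) / 2
    field_simp at this ⊢
    linear_combination -this
  obtain ⟨u₀, hu₀, hA₀⟩ := hθ.exists_A_ne_zero
  obtain ⟨x₀, hx₀, hG₀⟩ := hθ.exists_G_ne_zero
  have h00 := hGA x₀ hx₀ u₀ hu₀
  have hne : θ'.G (ε₅ * x₀ + ε₂) * θ'.A (ε₆ * u₀ + ε₃) ≠ 0 := by
    rw [h00]
    positivity
  have hG' := left_ne_zero_of_mul hne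
  have hA' := right_ne_zero_of_mul hne
  refine ⟨θ'.A (ε₆ * u₀ + ε₃) / θ.A u₀, div_ne_zero hA' hA₀, fun u hu => ?_, fun x hx => ?_, hW⟩
  · have h1 := hGA x₀ hx₀ u hu
    refine mul_left_cancel₀ hG' ?_
    rw [h1]
    field_simp
    field_simp at h00
    linear_combination -θ.A u * h00
  · have h1 := hGA x hx u₀ hu₀
    refine mul_right_cancel₀ hA' ?_
    rw [h1]
    field_simp

theorem transform_inImageClass (h : IsAffineOn I J K φ ε₁ ε₂ ε₃ ε₄ ε₅ ε₆)
    (hB : IsOpenBox I J K) {ε₇ : ℝ} (h₇ : ε₇ ≠ 0) (hθ : θ.InClass r I J K) :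
    (θ.transform ε₁ ε₂ ε₃ ε₄ ε₅ ε₆ ε₇).InImageClass r (box I J K) φ := by
  have h₄ := h.ne₄
  have h₅ := h.ne₅
  have h₆ := h.ne₆
  have hφ : ∀ p ∈ box I J K, φ p = (ε₄ * p.1 + ε₁, ε₅ * p.2.1 + ε₂, ε₆ * p.2.2 + ε₃) :=
    fun p hp => h.eq _ hp.1 _ hp.2.1 _ hp.2.2
  refine ⟨?_, ?_, ?_, ?_, ?_⟩
  · refine contDiffOn_const.mul (hθ.contDiffOn_A.comp (by fun_prop) ?_)
    rintro _ ⟨p, hp, rfl⟩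
    simpa [hφ p hp, h₆] using hp.2.2
  · refine contDiffOn_const.mul (hθ.contDiffOn_G.comp (by fun_prop) ?_)
    rintro _ ⟨p, hp, rfl⟩
    simpa [hφ p hp, h₅] using hp.2.1
  · refine contDiffOn_const.mul (hθ.contDiffOn_W.comp (by fun_prop) ?_)
    rintro _ ⟨p, hp, rfl⟩
    simpa [hφ p hp, h₄] using hp.1
  · obtain ⟨u, hu, hne⟩ := hθ.exists_A_ne_zero
    obtain ⟨t, ht⟩ := hB.nonempty_I
    obtain ⟨x, hx⟩ := hB.nonempty_J
    exact ⟨_, ⟨(t, x, u), ⟨ht, hx, hu⟩, rfl⟩, by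
      simp [Elements.transform, h.eq t ht x hx u hu, h₆, h₇, hne]⟩
  · obtain ⟨x, hx, hne⟩ := hθ.exists_G_ne_zero
    obtain ⟨t, ht⟩ := hB.nonempty_I
    obtain ⟨u, hu⟩ := hB.nonempty_K
    exact ⟨_, ⟨(t, x, u), ⟨ht, hx, hu⟩, rfl⟩, by
      simp [Elements.transform, h.eq t ht x hx u hu, h₄, h₅, h₇, hne]⟩

theorem isExtendedEquivalenceTransformation (h : IsAffineOn I J K φ ε₁ ε₂ ε₃ ε₄ ε₅ ε₆)
    (hr : 2 ≤ r) (hB : IsOpenBox I J K) {ε₇ : ℝ} (h₇ : ε₇ ≠ 0)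
    {F : ℝ × ℝ × ℝ → ℝ × ℝ × ℝ → ℝ × ℝ × ℝ}
    (hF : ∀ p ∈ box I J K, ∀ a g w : ℝ,
      F p (a, g, w) = (ε₇ * a, ε₄⁻¹ * ε₅ ^ 2 * ε₇⁻¹ * g, ε₄⁻¹ * ε₆ * w)) :
    IsExtendedEquivalenceTransformation r I J K φ F := by
  have h₄ := h.ne₄
  have h₅ := h.ne₅
  have h₆ := h.ne₆
  refine ⟨h.isPointTransformation hB, fun θ hθ => ?_⟩
  have hcl := h.transform_inImageClass hB h₇ hθ
  refine ⟨_, hcl, fun p hp => ?_, h.mapsEquation_of_eq hr hB hθ hcl h₇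
    (fun u _ => by simp [Elements.transform, h₆]) (fun x _ => by simp [Elements.transform, h₅])
    (fun t _ => by simp [Elements.transform, h₄])⟩
  have hφ : φ p = (ε₄ * p.1 + ε₁, ε₅ * p.2.1 + ε₂, ε₆ * p.2.2 + ε₃) :=
    h.eq _ hp.1 _ hp.2.1 _ hp.2.2
  rw [hF p hp, hφ]
  simp [Elements.transform, h₄, h₅, h₆]

end IsAffineOn

theorem IsExtendedEquivalenceTransformation.isEquivalenceTransformation {r : WithTop ℕ∞}
    {I J K : Set ℝ} {φ : ℝ × ℝ × ℝ → ℝ × ℝ × ℝ} {F : ℝ × ℝ × ℝ → ℝ × ℝ × ℝ → ℝ × ℝ × ℝ}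
    (h : IsExtendedEquivalenceTransformation r I J K φ F) :
    IsEquivalenceTransformation r I J K φ :=
  ⟨h.1, fun θ hθ => (h.2 θ hθ).imp fun _ h' => ⟨h'.1, h'.2.2⟩⟩

/-! ### The action on the arbitrary elements -/

/-- The linear function with value `c₀` at `s₀` and `c₁` at `s₁`. -/
noncomputable def interpolate (s₀ c₀ s₁ c₁ : ℝ) (s : ℝ) : ℝ :=
  c₀ + (c₁ - c₀) * ((s - s₀) / (s₁ - s₀))

theorem interpolate_left (s₀ c₀ s₁ c₁ : ℝ) : interpolate s₀ c₀ s₁ c₁ s₀ = c₀ := by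
  simp [interpolate]

theorem interpolate_right {s₀ c₀ s₁ c₁ : ℝ} (h : s₁ ≠ s₀) : interpolate s₀ c₀ s₁ c₁ s₁ = c₁ := by
  have : s₁ - s₀ ≠ 0 := sub_ne_zero.2 h
  simp [interpolate, this]

theorem contDiff_interpolate {n : WithTop ℕ∞} {s₀ c₀ s₁ c₁ : ℝ} :
    ContDiff ℝ n (interpolate s₀ c₀ s₁ c₁) := by
  unfold interpolate
  fun_prop

/-- There are elements of the class with arbitrary values at a given point of the box and the
values `(1, 1, 0)` at another one. -/
theorem exists_inClass_interpolating {r : WithTop ℕ∞} {I J K : Set ℝ} (hB : IsOpenBox I J K)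
    {p : ℝ × ℝ × ℝ} (hp : p ∈ box I J K) (a g w : ℝ) :
    ∃ p₁ ∈ box I J K, ∃ θ : Elements, θ.InClass r I J K ∧
      (θ.A p.2.2, θ.G p.2.1, θ.W p.1) = (a, g, w) ∧
      (θ.A p₁.2.2, θ.G p₁.2.1, θ.W p₁.1) = (1, 1, 0) := by
  obtain ⟨t₁, ht₁, ht⟩ := exists_mem_ne hB.isOpen_I hp.1
  obtain ⟨x₁, hx₁, hx⟩ := exists_mem_ne hB.isOpen_J hp.2.1
  obtain ⟨u₁, hu₁, hu⟩ := exists_mem_ne hB.isOpen_K hp.2.2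
  exact ⟨(t₁, x₁, u₁), ⟨ht₁, hx₁, hu₁⟩,
    ⟨interpolate p.2.2 a u₁ 1, interpolate p.2.1 g x₁ 1, interpolate p.1 w t₁ 0⟩,
    ⟨contDiff_interpolate.contDiffOn, contDiff_interpolate.contDiffOn,
      contDiff_interpolate.contDiffOn, ⟨u₁, hu₁, by simp [interpolate_right hu]⟩,
      ⟨x₁, hx₁, by simp [interpolate_right hx]⟩⟩,
    by simp [interpolate_left], by simp [interpolate_right, ht, hx, hu]⟩

/-- The constant `ε₇` of each equation is determined by the value of `F` at any one point with
`A ≠ 0`; through interpolating elements it is the same for all equations. -/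
theorem IsExtendedEquivalenceTransformation.exists_forall_eq {r : WithTop ℕ∞} {I J K : Set ℝ}
    {φ : ℝ × ℝ × ℝ → ℝ × ℝ × ℝ} {F : ℝ × ℝ × ℝ → ℝ × ℝ × ℝ → ℝ × ℝ × ℝ}
    {ε₁ ε₂ ε₃ ε₄ ε₅ ε₆ : ℝ} (h : IsExtendedEquivalenceTransformation r I J K φ F)
    (hφ : IsAffineOn I J K φ ε₁ ε₂ ε₃ ε₄ ε₅ ε₆) (hr : 2 ≤ r) (hB : IsOpenBox I J K) :
    ∃ ε₇ : ℝ, ε₇ ≠ 0 ∧ ∀ p ∈ box I J K, ∀ a g w : ℝ,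
      F p (a, g, w) = (ε₇ * a, ε₄⁻¹ * ε₅ ^ 2 * ε₇⁻¹ * g, ε₄⁻¹ * ε₆ * w) := by
  have hθ : ∀ θ : Elements, θ.InClass r I J K → ∃ ε₇ : ℝ, ε₇ ≠ 0 ∧ ∀ p ∈ box I J K,
      F p (θ.A p.2.2, θ.G p.2.1, θ.W p.1) =
        (ε₇ * θ.A p.2.2, ε₄⁻¹ * ε₅ ^ 2 * ε₇⁻¹ * θ.G p.2.1, ε₄⁻¹ * ε₆ * θ.W p.1) := by
    intro θ hθ
    obtain ⟨θ', hθ', hF, hmap⟩ := h.2 θ hθ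
    obtain ⟨ε₇, h₇, hA, hG, hW⟩ := (hφ.mapsEquation_iff hr hB hθ hθ').1 hmap
    refine ⟨ε₇, h₇, fun p hp => ?_⟩
    have hp' : φ p = (ε₄ * p.1 + ε₁, ε₅ * p.2.1 + ε₂, ε₆ * p.2.2 + ε₃) :=
      hφ.eq _ hp.1 _ hp.2.1 _ hp.2.2
    rw [← hF p hp, hp', hA _ hp.2.2, hG _ hp.2.1, hW _ hp.1]
  -- the constant belonging to the elements `(1, 1, 0)` serves for all elements
  obtain ⟨ε₇, h₇, h₀⟩ := hθ heat (heat_inClass hB)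
  refine ⟨ε₇, h₇, fun p hp a g w => ?_⟩
  obtain ⟨p₁, hp₁, θ, hcl, hv, hv₁⟩ := exists_inClass_interpolating (r := r) hB hp a g w
  obtain ⟨ε, -, hε⟩ := hθ θ hcl
  have e₁ := hε p₁ hp₁
  have e₀ := h₀ p₁ hp₁
  have e := hε p hp
  simp only [Prod.mk.injEq] at hv hv₁
  rw [hv₁.1, hv₁.2.1, hv₁.2.2] at e₁
  rw [hv.1, hv.2.1, hv.2.2] at e
  have : ε = ε₇ := by simpa [heat] using congrArg Prod.fst (e₁.symm.trans e₀)
  rw [e, this]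

end RadiantPlasma

theorem theorem1 (r : WithTop ℕ∞) (hr : 2 ≤ r) (I J K : Set ℝ)
    (hI : IsOpen I) (hJ : IsOpen J) (hK : IsOpen K)
    (hI' : I.OrdConnected) (hJ' : J.OrdConnected) (hK' : K.OrdConnected)
    (hI₀ : I.Nonempty) (hJ₀ : J.Nonempty) (hK₀ : K.Nonempty) :
    -- the transformations of the variables
    (∀ φ : ℝ × ℝ × ℝ → ℝ × ℝ × ℝ,
      RadiantPlasma.IsEquivalenceTransformation r I J K φ ↔
        ∃ ε₁ ε₂ ε₃ ε₄ ε₅ ε₆ : ℝ, ε₄ ≠ 0 ∧ ε₅ ≠ 0 ∧ ε₆ ≠ 0 ∧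
          ∀ t ∈ I, ∀ x ∈ J, ∀ u ∈ K,
            φ (t, x, u) = (ε₄ * t + ε₁, ε₅ * x + ε₂, ε₆ * u + ε₃)) ∧
    -- which equation of the class is moved to which
    (∀ (φ : ℝ × ℝ × ℝ → ℝ × ℝ × ℝ) (ε₁ ε₂ ε₃ ε₄ ε₅ ε₆ : ℝ), ε₄ ≠ 0 → ε₅ ≠ 0 → ε₆ ≠ 0 →
      (∀ t ∈ I, ∀ x ∈ J, ∀ u ∈ K,
        φ (t, x, u) = (ε₄ * t + ε₁, ε₅ * x + ε₂, ε₆ * u + ε₃)) →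
      ∀ θ θ' : RadiantPlasma.Elements, θ.InClass r I J K →
        θ'.InImageClass r (RadiantPlasma.box I J K) φ →
        (RadiantPlasma.MapsEquation (RadiantPlasma.box I J K) φ θ θ' ↔
          ∃ ε₇ : ℝ, ε₇ ≠ 0 ∧
            (∀ u ∈ K, θ'.A (ε₆ * u + ε₃) = ε₇ * θ.A u) ∧
            (∀ x ∈ J, θ'.G (ε₅ * x + ε₂) = ε₄⁻¹ * ε₅ ^ 2 * ε₇⁻¹ * θ.G x) ∧
            (∀ t ∈ I, θ'.W (ε₄ * t + ε₁) = ε₄⁻¹ * ε₆ * θ.W t))) ∧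
    -- the transformations of the variables and the arbitrary elements jointly
    (∀ (φ : ℝ × ℝ × ℝ → ℝ × ℝ × ℝ) (F : ℝ × ℝ × ℝ → ℝ × ℝ × ℝ → ℝ × ℝ × ℝ),
      RadiantPlasma.IsExtendedEquivalenceTransformation r I J K φ F ↔
        ∃ ε₁ ε₂ ε₃ ε₄ ε₅ ε₆ ε₇ : ℝ, ε₄ ≠ 0 ∧ ε₅ ≠ 0 ∧ ε₆ ≠ 0 ∧ ε₇ ≠ 0 ∧
          ∀ t ∈ I, ∀ x ∈ J, ∀ u ∈ K,
            φ (t, x, u) = (ε₄ * t + ε₁, ε₅ * x + ε₂, ε₆ * u + ε₃) ∧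
            ∀ a g w : ℝ,
              F (t, x, u) (a, g, w) =
                (ε₇ * a, ε₄⁻¹ * ε₅ ^ 2 * ε₇⁻¹ * g, ε₄⁻¹ * ε₆ * w)) := by
  have hB : RadiantPlasma.IsOpenBox I J K := ⟨hI, hJ, hK, hI', hJ', hK', hI₀, hJ₀, hK₀⟩
  refine ⟨fun φ => ⟨fun h => h.exists_affine hr hB, ?_⟩, ?_, fun φ F => ⟨fun h => ?_, ?_⟩⟩
  · rintro ⟨ε₁, ε₂, ε₃, ε₄, ε₅, ε₆, h₄, h₅, h₆, hφ⟩
    have hA : RadiantPlasma.IsAffineOn I J K φ ε₁ ε₂ ε₃ ε₄ ε₅ ε₆ := ⟨h₄, h₅, h₆, hφ⟩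
    exact (hA.isExtendedEquivalenceTransformation hr hB one_ne_zero
      (F := fun _ e => (1 * e.1, ε₄⁻¹ * ε₅ ^ 2 * 1⁻¹ * e.2.1, ε₄⁻¹ * ε₆ * e.2.2))
      fun p _ a g w => rfl).isEquivalenceTransformation
  · intro φ ε₁ ε₂ ε₃ ε₄ ε₅ ε₆ h₄ h₅ h₆ hφ θ θ' hθ hθ'
    have hA : RadiantPlasma.IsAffineOn I J K φ ε₁ ε₂ ε₃ ε₄ ε₅ ε₆ := ⟨h₄, h₅, h₆, hφ⟩
    exact hA.mapsEquation_iff hr hB hθ hθ'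
  · obtain ⟨ε₁, ε₂, ε₃, ε₄, ε₅, ε₆, h₄, h₅, h₆, hφ⟩ :=
      h.isEquivalenceTransformation.exists_affine hr hB
    obtain ⟨ε₇, h₇, hF⟩ := h.exists_forall_eq ⟨h₄, h₅, h₆, hφ⟩ hr hB
    exact ⟨ε₁, ε₂, ε₃, ε₄, ε₅, ε₆, ε₇, h₄, h₅, h₆, h₇, fun t ht x hx u hu =>
      ⟨hφ t ht x hx u hu, hF _ ⟨ht, hx, hu⟩⟩⟩
  · rintro ⟨ε₁, ε₂, ε₃, ε₄, ε₅, ε₆, ε₇, h₄, h₅, h₆, h₇, hφ⟩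
    have hA : RadiantPlasma.IsAffineOn I J K φ ε₁ ε₂ ε₃ ε₄ ε₅ ε₆ :=
      ⟨h₄, h₅, h₆, fun t ht x hx u hu => (hφ t ht x hx u hu).1⟩
    exact hA.isExtendedEquivalenceTransformation hr hB h₇
      fun p hp => (hφ p.1 hp.1 p.2.1 hp.2.1 p.2.2 hp.2.2).2
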